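/- **Setting.** Let $Z_i=(X_i,Y_i)$, $i=1,\dots,n$, be independent (not necessarily identically distributed) random elements of $\mathcal X\times\mathcal Y$, $\mathcal Y\subseteq\mathbb R$. Let $\mathbf F$ be a real vector space of functions $f:\mathcal X\to\mathbb R$ with a norm (or seminorm) $\|\cdot\|$, and for $f\in\mathbf F$ let $\rho_f:\mathcal X\times\mathcal Y\to\mathbb R$ be a loss, measurable, with $\rho_f(Z_i)$ integrable, such that $f\mapsto\rho_f(z)$ is convex for every $z$. Write $P_n\rho_f=\frac1n\sum_i\rho_f(Z_i)$, $P\rho_f=\frac1n\sum_iE\rho_f(Z_i)$, let $f^0$ be a minimizer of $P\rho_f$ over $\mathbf F$, and $\Xi(f)=P(\rho_f-\rho_{f^0})$. Let $\psi_1,\dots,\psi_p\in\mathbf F$ be measurable, $f_\beta=\sum_j\beta_j\psi_j$ for $\beta\in\mathbb R^p$, and let $\Phi\subseteq\mathbb R^p$ be a convex parameter set. For $\beta\in\mathbb R^p$ and $S\subseteq\{1,\dots,p\}$ let $\beta_S=(\beta_j1_{\{j\in S\}})_j$, $S_\beta=\{j:\beta_j\ne0\}$, $s_\beta=|S_\beta|$.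 Let $\lambda_1>0$, $\lambda_2\ge0$, and let $\hat f=f_{\hat\beta}$, where $\hat\beta$ minimizes $P_n\rho_{f_\beta}+\lambda_1\|\beta\|_1+\lambda_2\|\beta\|_2^2$ over $\beta\in\Phi$. Let $G$ be strictly convex on $[0,\infty)$ with $G(0)=0$, and let $H(v)=\sup_{u\ge0}\{uv-G(u)\}\in[0,\infty]$ be its convex conjugate ($H(\infty)=\infty$). For $\beta\in\mathbb R^p$ with support $S=S_\beta$ let $\phi(S_\beta)\in[0,\infty]$ be given by $$\phi^2(S_\beta)=\min\Big\{\frac{\|f_\delta\|^2}{\|\delta_S\|_2^2}:\ \delta\in\mathbb R^p\setminus\{0\},\ \|\delta_{S^c}\|_1\le L\|\delta_S\|_2\Big\},\qquad L=3\Big(\sqrt{|S|}+\frac{2\lambda_2\|\beta_S\|_2}{\lambda_1}\Big)$$ ($=\infty$ if $S=\emptyset$). Given a collection $\Gamma$ of subsets of $\{1,\dots,p\}$, let the oracle $\beta^*$ be a minimizer of $$3\,\Xi(f_\beta)+2H\Big(\frac{4\lambda_1\sqrt{s_\beta}+4\lambda_2\|\beta\|_2}{\phi(S_\beta)}\Big)$$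 over all $\beta\in\Phi$ with $S_\beta\in\Gamma$. Put $f^*=f_{\beta^*}$, $S^*=S_{\beta^*}$, $s^*=|S^*|$, $\phi_*=\phi(S^*)$, and let $2\Delta^*$ be the minimum value of this objective, that is, $2\Delta^*=3\,\Xi(f^*)+2H\big((4\lambda_1\sqrt{s^*}+4\lambda_2\|\beta^*\|_2)/\phi_*\big)$. **Theorem.** For every $K>0$ there is a constant $d>0$, depending only on $K$, such that the following holds. Let $p\ge2$, $\log p\le n$, and assume, in addition to the setting: 1. $\rho_f(x,y)=\gamma(y,f(x))+c(f)$, and for some $D>0$, $|\gamma(y,f_\beta(x))-\gamma(y,f_{\tilde\beta}(x))|\le D|f_\beta(x)-f_{\tilde\beta}(x)|$ for all $(x,y)$ and all $\beta,\tilde\beta\in\Phi$; 2. $\frac1n\sum_{i=1}^n\max_{j}E\psi_j^2(X_i)\le1$ and $\max_j\sup_x|\psi_j(x)|\le K$; 3. (margin condition) for some $\eta>0$, $\Xi(f)\ge G(\|f-f^0\|)$ for all $f\in\mathbf F_{\rm local}=\{f\in\mathbf F:\sup_x|f(x)-f^0(x)|\le\eta\}$; 4. $\lambda_0=dD\sqrt{\log(p)/n}$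 and $\lambda_1\ge8\lambda_0$; 5. $f^*\in\mathbf F_{\rm local}$, and $f_\beta\in\mathbf F_{\rm local}$ for all $\beta\in\Phi$ with $\|\beta-\beta^*\|_1\le M^*:=\Delta^*/\lambda_0$; 6. (adaptive restricted eigenvalue condition) $\phi_*>0$. Then with probability at least $1-\frac1p$ $$\Xi(\hat f)+\lambda_1\|\hat\beta-\beta^*\|_1+\lambda_2\|\hat\beta_{S^*}-\beta^*_{S^*}\|_2^2\ \le\ 4\Delta^*=6\,\Xi(f^*)+4H\Big(\frac{4\lambda_1\sqrt{s^*}+4\lambda_2\|\beta^*\|_2}{\phi_*}\Big).$$ -/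

import Mathlib

open MeasureTheory ProbabilityTheory
open scoped ENNReal NNReal

namespace ElasticNet

noncomputable section

/-- The `ℓ₁`-norm on `ℝ^p`. -/
def l1norm {p : ℕ} (β : Fin p → ℝ) : ℝ := ∑ j, |β j|

/-- The `ℓ₂`-norm on `ℝ^p`. -/
def l2norm {p : ℕ} (β : Fin p → ℝ) : ℝ := Real.sqrt (∑ j, β j ^ 2)

/-- `β_S`: the coordinates outside `S` are set to zero. -/
def restr {p : ℕ} (S : Finset (Fin p)) (β : Fin p → ℝ) : Fin p → ℝ :=
  fun j => if j ∈ S then β j else 0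

/-- `S_β`: the indices of the non-zero coefficients. -/
def supp {p : ℕ} (β : Fin p → ℝ) : Finset (Fin p) :=
  Finset.univ.filter (fun j => β j ≠ 0)

/-- The linear combination `f_β = ∑ j, β j • ψ j`, an element of the function space `F`. -/
def lin {𝒳 : Type*} {F : Submodule ℝ (𝒳 → ℝ)} {p : ℕ} (ψ : Fin p → F) (β : Fin p → ℝ) : F :=
  ∑ j, β j • ψ j

/-- The empirical risk `P_n ρ_f` of a realised sample `z`. -/
def empRisk {𝒵 : Type*} {n : ℕ} (z : Fin n → 𝒵) (r : 𝒵 → ℝ) : ℝ :=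
  (1 / (n : ℝ)) * ∑ i, r (z i)

/-- The population mean `P r = n⁻¹ ∑ i, E r(Z_i)`. -/
def popMean {Ω 𝒵 : Type*} [MeasurableSpace Ω] (μ : Measure Ω) {n : ℕ}
    (Z : Fin n → Ω → 𝒵) (r : 𝒵 → ℝ) : ℝ :=
  (1 / (n : ℝ)) * ∑ i, ∫ ω, r (Z i ω) ∂μ

/-- The excess risk `Ξ(f) = P(ρ_f - ρ_{f⁰})`. -/
def excess {Ω 𝒵 𝓕 : Type*} [MeasurableSpace Ω] (μ : Measure Ω) {n : ℕ}
    (Z : Fin n → Ω → 𝒵) (ρ : 𝓕 → 𝒵 → ℝ) (f0 f : 𝓕) : ℝ :=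
  popMean μ Z (fun z => ρ f z - ρ f0 z)

/-- The sup-norm neighbourhood `{f ∈ F : ‖f - f⁰‖_∞ ≤ η}`. -/
def localSet {𝒳 : Type*} (F : Submodule ℝ (𝒳 → ℝ)) (f0 : F) (η : ℝ) : Set F :=
  {f | ∀ x, |(f : 𝒳 → ℝ) x - (f0 : 𝒳 → ℝ) x| ≤ η}

/-- The convex conjugate `H(v) = sup_{u ≥ 0} (u v - G(u))`. The supremum is taken in the extended
reals, since it may be infinite; the argument ranges over `[0, ∞]` with `H(∞) = ∞`. -/
def conj (G : ℝ → ℝ) (v : ℝ≥0∞) : EReal :=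
  ⨆ u : ℝ≥0, (((u : ℝ≥0∞) * v : ℝ≥0∞) : EReal) - ((G (u : ℝ) : ℝ) : EReal)

/-- The constant `L = 3 (√|S| + 2 λ₂ ‖β_S‖₂ / λ₁)` of the restricted set. -/
def coneConst {p : ℕ} (l1 l2 : ℝ) (S : Finset (Fin p)) (β : Fin p → ℝ) : ℝ :=
  3 * (Real.sqrt (S.card : ℝ) + 2 * l2 * l2norm (restr S β) / l1)

/-- The square of the adaptive restricted eigenvalue for the set `S` at the coefficient vector `β`:
the smallest value of `‖f_δ‖² / ‖δ_S‖₂²` over `δ ≠ 0` with `‖δ_{Sᶜ}‖₁ ≤ L ‖δ_S‖₂`.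
It is `∞` if there is no such `δ`, which happens for `S = ∅`. -/
def phiSq {𝒳 : Type*} {F : Submodule ℝ (𝒳 → ℝ)} {p : ℕ} (N : Seminorm ℝ F) (ψ : Fin p → F)
    (l1 l2 : ℝ) (S : Finset (Fin p)) (β : Fin p → ℝ) : ℝ≥0∞ :=
  ⨅ (δ : Fin p → ℝ) (_ : δ ≠ 0)
    (_ : l1norm (restr Sᶜ δ) ≤ coneConst l1 l2 S β * l2norm (restr S δ)),
    ENNReal.ofReal (N (lin ψ δ) ^ 2 / l2norm (restr S δ) ^ 2)

/-- `φ(S_β)`, the adaptive restricted eigenvalue for the support of `β`. -/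
def phi {𝒳 : Type*} {F : Submodule ℝ (𝒳 → ℝ)} {p : ℕ} (N : Seminorm ℝ F) (ψ : Fin p → F)
    (l1 l2 : ℝ) (β : Fin p → ℝ) : ℝ≥0∞ :=
  (phiSq N ψ l1 l2 (supp β) β) ^ (1 / 2 : ℝ)

/-- The estimation error term `H((4 λ₁ √s_β + 4 λ₂ ‖β‖₂) / φ(S_β))`. -/
def estError {𝒳 : Type*} {F : Submodule ℝ (𝒳 → ℝ)} {p : ℕ} (N : Seminorm ℝ F) (ψ : Fin p → F)
    (G : ℝ → ℝ) (l1 l2 : ℝ) (β : Fin p → ℝ) : EReal :=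
  conj G (ENNReal.ofReal (4 * l1 * Real.sqrt ((supp β).card : ℝ) + 4 * l2 * l2norm β)
    / phi N ψ l1 l2 β)

/-- The objective function of the oracle, `3 Ξ(f_β) + 2 H(…)`, where `Xi` is the excess risk. -/
def oracleObj {𝒳 : Type*} {F : Submodule ℝ (𝒳 → ℝ)} {p : ℕ} (Xi : F → ℝ) (N : Seminorm ℝ F)
    (ψ : Fin p → F) (G : ℝ → ℝ) (l1 l2 : ℝ) (β : Fin p → ℝ) : EReal :=
  3 * ((Xi (lin ψ β) : ℝ) : EReal) + 2 * estError N ψ G l1 l2 β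

/-- `β` is an oracle: it minimises the oracle objective over the parameters in `Φ` whose support
belongs to the collection `Γ`. -/
def IsOracle {𝒳 : Type*} {F : Submodule ℝ (𝒳 → ℝ)} {p : ℕ} (Xi : F → ℝ) (N : Seminorm ℝ F)
    (ψ : Fin p → F) (G : ℝ → ℝ) (l1 l2 : ℝ) (Φ : Set (Fin p → ℝ)) (Γ : Set (Finset (Fin p)))
    (β : Fin p → ℝ) : Prop :=
  β ∈ Φ ∧ supp β ∈ Γ ∧
    ∀ b ∈ Φ, supp b ∈ Γ → oracleObj Xi N ψ G l1 l2 β ≤ oracleObj Xi N ψ G l1 l2 b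

/-- The oracle bound `Δ`, half the value of the oracle objective. -/
def oracleBound {𝒳 : Type*} {F : Submodule ℝ (𝒳 → ℝ)} {p : ℕ} (Xi : F → ℝ) (N : Seminorm ℝ F)
    (ψ : Fin p → F) (G : ℝ → ℝ) (l1 l2 : ℝ) (β : Fin p → ℝ) : EReal :=
  oracleObj Xi N ψ G l1 l2 β / 2

/-- `b` is an elastic net estimate for the realised sample `z`. -/
def IsElasticNet {𝒳 𝒵 : Type*} {F : Submodule ℝ (𝒳 → ℝ)} {n p : ℕ} (ρ : F → 𝒵 → ℝ)
    (ψ : Fin p → F) (l1 l2 : ℝ) (Φ : Set (Fin p → ℝ)) (z : Fin n → 𝒵) (b : Fin p → ℝ) : Prop :=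
  b ∈ Φ ∧ ∀ β ∈ Φ,
    empRisk z (ρ (lin ψ b)) + l1 * l1norm b + l2 * l2norm b ^ 2
      ≤ empRisk z (ρ (lin ψ β)) + l1 * l1norm β + l2 * l2norm β ^ 2

end

end ElasticNet

open ElasticNet

/-! The probabilistic input is one event of probability at least `1 - 1/p` on which the centred
empirical process, over the coefficients in `Φ` within `ℓ₁`-distance `M` of the oracle, is at most
`λ₀ M`. Everything else is deterministic.

For the event, the exponential moment of the supremum is bounded directly, removing one observation
at a time. AM-GM and Jensen separate a summand from its mean, a contraction for one sign replaces
the Lipschitz loss by the linear process, and the resulting linear term merely shifts the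
coefficient vector carried by the induction (`lintegral_expSup_pi_le`). After all observations are
removed, `ℓ₁`-`ℓ_∞` duality leaves a sum of `p` hyperbolic cosines, which is the source of `log p`.
Markov's inequality, then countable unions and a dense sequence, give
`exists_measurableSet_forall_le`.

On the event, minimality of the estimator, decomposability of the `ℓ₁`-norm and expansion of the
squared `ℓ₂`-norm yield a basic inequality. Either its right side is dominated by `λ₀ M + Ξ(f*)`, or
the error lies in the restricted cone; then the eigenvalue passes to `‖f_δ‖`, the triangle
inequality through `f⁰` splits this norm, and the margin condition with Fenchel-Young returns excess
risks plus `H` (`oracle_inequality_of_mem_ball`). Convexity removes the prior assumption that the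
estimator is in the ball (`oracle_inequality_of_isMin`).

The radius is `M = Δ* / λ₀`. If `Δ* = 0` this ball is degenerate, so radii tending to `0` are used
instead. This needs a margin condition beyond the local set (`linear_margin`) and an event that
combines those of all radii (`exists_measurableSet_frequently`). -/

namespace ElasticNet

/-! ### Suprema of exponentials: symmetrisation and contraction in one variable. -/

/-- The supremum of `exp (u i)` over a finite index set. -/
noncomputable def expSup {ι : Type*} (u : ι → ℝ) : ℝ := ⨆ i, Real.exp (u i)

lemma exp_le_expSup {ι : Type*} [Finite ι] (u : ι → ℝ) (i : ι) : Real.exp (u i) ≤ expSup u :=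
  le_ciSup (f := fun i => Real.exp (u i)) (Set.finite_range _).bddAbove i

lemma expSup_le {ι : Type*} [Nonempty ι] {u : ι → ℝ} {c : ℝ} (h : ∀ i, Real.exp (u i) ≤ c) : expSup u ≤ c :=
  ciSup_le h

lemma measurable_expSup {ι : Type*} [Finite ι] {α : Type*} [MeasurableSpace α] {u : α → ι → ℝ}
    (hu : ∀ i, Measurable fun x => u x i) : Measurable fun x => expSup (u x) :=
  Measurable.iSup fun i => Real.measurable_exp.comp (hu i)

section ExpSup

variable {ι : Type*} [Finite ι] [Nonempty ι]

lemma exists_expSup_eq (u : ι → ℝ) : ∃ i, expSup u = Real.exp (u i) := by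
  obtain ⟨i, hi⟩ := exists_eq_ciSup_of_finite (f := fun i => Real.exp (u i))
  exact ⟨i, hi.symm⟩

lemma expSup_pos (u : ι → ℝ) : 0 < expSup u := by
  obtain ⟨i, hi⟩ := exists_expSup_eq u
  rw [hi]; exact Real.exp_pos _

/-- AM-GM inside the exponential. It separates a mean `a` from a sample value `b` without a ghost
sample, at the price of doubling both. -/
lemma expSup_add_sub_le (u a b : ι → ℝ) :
    expSup (fun i => u i + a i - b i)
      ≤ (expSup (fun i => u i + 2 * a i) + expSup (fun i => u i - 2 * b i)) / 2 := by
  refine expSup_le fun i => ?_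
  have h1 := exp_le_expSup (fun i => u i + 2 * a i) i
  have h2 := exp_le_expSup (fun i => u i - 2 * b i) i
  have e1 : Real.exp (u i + 2 * a i) = Real.exp (u i / 2 + a i) ^ 2 := by
    rw [← Real.exp_nat_mul]; congr 1; push_cast; ring
  have e2 : Real.exp (u i - 2 * b i) = Real.exp (u i / 2 - b i) ^ 2 := by
    rw [← Real.exp_nat_mul]; congr 1; push_cast; ring
  have e3 : Real.exp (u i + a i - b i)
      = Real.exp (u i / 2 + a i) * Real.exp (u i / 2 - b i) := by
    rw [← Real.exp_add]; congr 1; ring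
  simp only [e1, e2] at h1 h2
  rw [e3]
  nlinarith [sq_nonneg (Real.exp (u i / 2 + a i) - Real.exp (u i / 2 - b i))]

/-- Contraction for a single sign variable. -/
lemma expSup_contraction (u g h : ι → ℝ) (hgh : ∀ i k, |g i - g k| ≤ |h i - h k|)
    (hg : ∀ i, |g i| ≤ |h i|) :
    expSup (fun i => u i + g i) + expSup (fun i => u i - g i)
      ≤ expSup (fun i => u i + h i) + expSup (fun i => u i - h i) := by
  set A := expSup (fun i => u i + h i) with hA
  set B := expSup (fun i => u i - h i) with hB
  have hAi : ∀ i, Real.exp (u i + h i) ≤ A := exp_le_expSup (fun i => u i + h i)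
  have hBi : ∀ i, Real.exp (u i - h i) ≤ B := exp_le_expSup (fun i => u i - h i)
  have hA0 : 0 < A := expSup_pos _
  have hB0 : 0 < B := expSup_pos _
  obtain ⟨t, ht⟩ := exists_expSup_eq (fun i => u i + g i)
  obtain ⟨s, hs⟩ := exists_expSup_eq (fun i => u i - g i)
  rw [ht, hs]
  -- Domination of `|g|` by `|h|` bounds each of the two maxima by `max A B`; the increment
  -- condition bounds their product by `A * B`.
  have hmax : ∀ i, Real.exp (u i + |h i|) ≤ max A B := by
    intro i
    rcases abs_cases (h i) with ⟨e, -⟩ | ⟨e, -⟩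
    · rw [e]; exact (hAi i).trans (le_max_left _ _)
    · rw [e, ← sub_eq_add_neg]; exact (hBi i).trans (le_max_right _ _)
  have hx : Real.exp (u t + g t) ≤ max A B :=
    (Real.exp_le_exp.2 (by linarith [le_abs_self (g t), hg t])).trans (hmax t)
  have hy : Real.exp (u s - g s) ≤ max A B :=
    (Real.exp_le_exp.2 (by linarith [neg_abs_le (g s), hg s])).trans (hmax s)
  have hxy : Real.exp (u t + g t) * Real.exp (u s - g s) ≤ A * B := by
    rw [← Real.exp_add]
    have h1 : g t - g s ≤ |h t - h s| := (le_abs_self _).trans (hgh t s)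
    rcases abs_cases (h t - h s) with ⟨e, -⟩ | ⟨e, -⟩
    · calc _ ≤ Real.exp ((u t + h t) + (u s - h s)) := Real.exp_le_exp.2 (by linarith)
        _ ≤ A * B := by rw [Real.exp_add]; exact mul_le_mul (hAi t) (hBi s) (Real.exp_pos _).le hA0.le
    · calc _ ≤ Real.exp ((u s + h s) + (u t - h t)) := Real.exp_le_exp.2 (by linarith)
        _ ≤ A * B := by rw [Real.exp_add]; exact mul_le_mul (hAi s) (hBi t) (Real.exp_pos _).le hA0.le
  -- Expanding `(X - x) * (X - y) ≥ 0` gives `X * (x + y) ≤ X ^ 2 + x * y ≤ X * (X + Y)`.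
  have key : ∀ x y X Y : ℝ, 0 < X → x ≤ X → y ≤ X → x * y ≤ X * Y → x + y ≤ X + Y := by
    intro x y X Y hX h1 h2 h3
    have h4 : 0 ≤ (X - x) * (X - y) := mul_nonneg (by linarith) (by linarith)
    exact le_of_mul_le_mul_left (by nlinarith) hX
  rcases le_total A B with hAB | hAB
  · rw [max_eq_right hAB] at hx hy
    have := key _ _ B A hB0 hx hy (by linarith)
    linarith
  · rw [max_eq_left hAB] at hx hy
    exact key _ _ A B hA0 hx hy hxy

lemma abs_expSup_le {u : ι → ℝ} {C : ℝ} (h : ∀ i, |u i| ≤ C) : |expSup u| ≤ Real.exp C := by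
  rw [abs_of_pos (expSup_pos u)]
  exact expSup_le fun i => Real.exp_le_exp.2 ((le_abs_self _).trans (h i))

variable {𝒵 : Type*} [MeasurableSpace 𝒵] (ν : Measure 𝒵) [IsProbabilityMeasure ν]

lemma integrable_of_abs_le {f : 𝒵 → ℝ} (hf : Measurable f) {C : ℝ} (h : ∀ z, |f z| ≤ C) :
    Integrable f ν :=
  Integrable.of_bound hf.aestronglyMeasurable C (Filter.Eventually.of_forall h)

lemma integrable_expSup {u : 𝒵 → ι → ℝ} (hu : ∀ i, Measurable fun z => u z i) {C : ℝ}
    (hC : ∀ z i, |u z i| ≤ C) : Integrable (fun z => expSup (u z)) ν :=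
  integrable_of_abs_le ν (measurable_expSup hu) fun z => abs_expSup_le (hC z)

/-- Jensen's inequality at the index that attains the supremum on the left. -/
lemma expSup_add_integral_le (u : ι → ℝ) {g : ι → 𝒵 → ℝ} (hg : ∀ i, Measurable (g i)) {C : ℝ}
    (hC : ∀ i z, |g i z| ≤ C) :
    expSup (fun i => u i + ∫ z, g i z ∂ν) ≤ ∫ z, expSup (fun i => u i + g i z) ∂ν := by
  obtain ⟨i, hi⟩ := exists_expSup_eq (fun i => u i + ∫ z, g i z ∂ν)
  obtain ⟨k, hk⟩ := Finite.exists_max fun i => |u i|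
  have hint : Integrable (fun z => u i + g i z) ν :=
    (integrable_const _).add (integrable_of_abs_le ν (hg i) (hC i))
  have hb : ∀ l z, |u l + g l z| ≤ |u k| + C := fun l z =>
    (abs_add_le _ _).trans (add_le_add (hk l) (hC l z))
  have hexp : Integrable (fun z => Real.exp (u i + g i z)) ν :=
    integrable_of_abs_le ν (Real.measurable_exp.comp (measurable_const.add (hg i)))
      (C := Real.exp (|u k| + C)) fun z => by
        rw [abs_of_pos (Real.exp_pos _)]
        exact Real.exp_le_exp.2 ((le_abs_self _).trans (hb i z))
  rw [hi]
  calc Real.exp (u i + ∫ z, g i z ∂ν) = Real.exp (∫ z, (u i + g i z) ∂ν) := by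
        rw [integral_add (integrable_const _) (integrable_of_abs_le ν (hg i) (hC i))]; simp
    _ ≤ ∫ z, Real.exp (u i + g i z) ∂ν :=
        convexOn_exp.map_integral_le Real.continuous_exp.continuousOn isClosed_univ
          (by simp) hint hexp
    _ ≤ _ := integral_mono hexp
        (integrable_expSup ν (fun l => measurable_const.add (hg l)) fun z l => hb l z)
        fun z => exp_le_expSup (fun i => u i + g i z) i

/-- Replacing one centred summand by a symmetrised, contracted one. -/
lemma integral_expSup_symm_contraction (u : ι → ℝ) {g h : ι → 𝒵 → ℝ}
    (hg : ∀ i, Measurable (g i)) (hh : ∀ i, Measurable (h i)) {C : ℝ}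
    (hC : ∀ i z, |h i z| ≤ C) (hgh : ∀ i k z, |g i z - g k z| ≤ |h i z - h k z|)
    (hg0 : ∀ i z, |g i z| ≤ |h i z|) :
    ∫ z, expSup (fun i => u i + (∫ z', g i z' ∂ν) - g i z) ∂ν
      ≤ ∫ z, (expSup (fun i => u i + 2 * h i z) + expSup (fun i => u i - 2 * h i z)) / 2 ∂ν := by
  obtain ⟨k, hk⟩ := Finite.exists_max fun i => |u i|
  have hgC : ∀ i z, |g i z| ≤ C := fun i z => (hg0 i z).trans (hC i z)
  have b2 : ∀ x : ℝ, |x| ≤ C → |2 * x| ≤ 2 * C := fun x hx => by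
    rw [abs_mul, abs_two]; linarith
  have ip : ∀ {f : ι → 𝒵 → ℝ}, (∀ i, Measurable (f i)) → (∀ i z, |f i z| ≤ C) →
      Integrable (fun z => expSup (fun i => u i + 2 * f i z)) ν := fun {f} hf hfC =>
    integrable_expSup ν (fun i => measurable_const.add ((hf i).const_mul 2)) (C := |u k| + 2 * C)
      fun z i => (abs_add_le _ _).trans (add_le_add (hk i) (b2 _ (hfC i z)))
  have im : ∀ {f : ι → 𝒵 → ℝ}, (∀ i, Measurable (f i)) → (∀ i z, |f i z| ≤ C) →
      Integrable (fun z => expSup (fun i => u i - 2 * f i z)) ν := fun {f} hf hfC =>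
    integrable_expSup ν (fun i => measurable_const.sub ((hf i).const_mul 2)) (C := |u k| + 2 * C)
      fun z i => (abs_sub _ _).trans (add_le_add (hk i) (b2 _ (hfC i z)))
  have hI : ∀ i, |∫ z', g i z' ∂ν| ≤ C := fun i => by
    have := norm_integral_le_of_norm_le_const (μ := ν) (f := g i) (C := C)
      (Filter.Eventually.of_forall fun z => hgC i z)
    simpa using this
  have hJ : expSup (fun i => u i + 2 * ∫ z', g i z' ∂ν)
      ≤ ∫ z, expSup (fun i => u i + 2 * g i z) ∂ν := by
    have := expSup_add_integral_le ν u (g := fun i z => 2 * g i z)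
      (fun i => (hg i).const_mul 2) (C := 2 * C) (fun i z => b2 _ (hgC i z))
    simpa only [integral_const_mul] using this
  calc ∫ z, expSup (fun i => u i + (∫ z', g i z' ∂ν) - g i z) ∂ν
      ≤ ∫ z, (expSup (fun i => u i + 2 * ∫ z', g i z' ∂ν)
          + expSup (fun i => u i - 2 * g i z)) / 2 ∂ν := by
        refine integral_mono (integrable_expSup ν (fun i => measurable_const.sub (hg i))
          (C := |u k| + C + C) fun z i => ?_) (((integrable_const _).add (im hg hgC)).div_const 2)
          fun z => expSup_add_sub_le _ _ _
        refine (abs_sub _ _).trans (add_le_add ((abs_add_le _ _).trans ?_) (hgC i z))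
        exact add_le_add (hk i) (hI i)
    _ ≤ ∫ z, (expSup (fun i => u i + 2 * g i z) + expSup (fun i => u i - 2 * g i z)) / 2 ∂ν := by
        rw [integral_div, integral_div, integral_add (integrable_const _) (im hg hgC),
          integral_add (ip hg hgC) (im hg hgC)]
        simp only [integral_const, probReal_univ, one_smul]
        linarith
    _ ≤ _ := by
        refine integral_mono (((ip hg hgC).add (im hg hgC)).div_const 2)
          (((ip hh hC).add (im hh hC)).div_const 2) fun z => ?_
        have := expSup_contraction u (fun i => 2 * g i z) (fun i => 2 * h i z)
          (fun i k => by
            rw [← mul_sub, ← mul_sub, abs_mul, abs_mul]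
            exact mul_le_mul_of_nonneg_left (hgh i k z) (abs_nonneg _))
          (fun i => by
            rw [abs_mul, abs_mul]
            exact mul_le_mul_of_nonneg_left (hg0 i z) (abs_nonneg _))
        simp only
        linarith

end ExpSup

/-! ### Exponential moments and tails of the empirical process. -/

/-- Hölder's inequality for `ℓ₁` and `ℓ_∞`. -/
lemma abs_sum_mul_le {κ : Type*} [Fintype κ] {a v : κ → ℝ} {M K : ℝ}
    (hK : 0 ≤ K) (ha : ∑ j, |a j| ≤ M) (hv : ∀ j, |v j| ≤ K) : |∑ j, a j * v j| ≤ M * K := by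
  calc |∑ j, a j * v j| ≤ ∑ j, |a j| * K := by
        refine (Finset.abs_sum_le_sum_abs _ _).trans (Finset.sum_le_sum fun j _ => ?_)
        rw [abs_mul]; exact mul_le_mul_of_nonneg_left (hv j) (abs_nonneg _)
    _ = (∑ j, |a j|) * K := by rw [Finset.sum_mul]
    _ ≤ M * K := mul_le_mul_of_nonneg_right ha hK

/-- Duality puts the supremum at a largest coordinate of `v`. The symmetric function `cosh` then
allows the maximum over coordinates to be replaced by a sum that factorises under sign averages. -/
lemma expSup_linear_le {ι κ : Type*} [Nonempty ι] [Fintype κ] [Nonempty κ] {a : ι → κ → ℝ}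
    {M : ℝ} (ha : ∀ i, ∑ j, |a i j| ≤ M) (v : κ → ℝ) :
    expSup (fun i => ∑ j, a i j * v j) ≤ 2 * ∑ j, Real.cosh (M * v j) := by
  obtain ⟨k, hk⟩ := Finite.exists_max fun j => |v j|
  have hM : 0 ≤ M := by
    obtain ⟨i⟩ := ‹Nonempty ι›
    exact (Finset.sum_nonneg fun j _ => abs_nonneg _).trans (ha i)
  refine expSup_le fun i => ?_
  calc Real.exp (∑ j, a i j * v j) ≤ Real.exp (|M * v k|) := by
        rw [abs_mul, abs_of_nonneg hM]
        exact Real.exp_le_exp.2 ((le_abs_self _).trans (abs_sum_mul_le (abs_nonneg _) (ha i) hk))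
    _ ≤ 2 * Real.cosh (M * v k) := by
        rw [← Real.cosh_abs, Real.cosh_eq]
        linarith [Real.exp_pos (-|M * v k|)]
    _ ≤ _ := by
        have := Finset.single_le_sum (f := fun j => Real.cosh (M * v j))
          (fun j _ => (Real.cosh_pos _).le) (Finset.mem_univ k)
        linarith

/-- The sub-Gaussian cost of averaging over one sign: the addition formulas leave the factor `cosh y
≤ exp (y ^ 2 / 2)`. -/
lemma cosh_add_add_cosh_sub_le (x y c : ℝ) (hy : |y| ≤ c) :
    (Real.cosh (x + y) + Real.cosh (x - y)) / 2 ≤ Real.cosh x * Real.exp (c ^ 2 / 2) := by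
  have h : (Real.cosh (x + y) + Real.cosh (x - y)) / 2 = Real.cosh x * Real.cosh y := by
    rw [Real.cosh_add, Real.cosh_sub]; ring
  rw [h]
  refine mul_le_mul_of_nonneg_left ((Real.cosh_le_exp_half_sq y).trans ?_) (Real.cosh_pos x).le
  refine Real.exp_le_exp.2 ?_
  have := sq_le_sq' (abs_le.1 hy).1 (abs_le.1 hy).2
  linarith

/-- Exponential moment of the supremum of a centred empirical process whose increments are
dominated by those of a linear process. -/
lemma lintegral_expSup_pi_le {ι κ 𝒵 : Type*} [Finite ι] [Nonempty ι] [Fintype κ] [Nonempty κ]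
    [MeasurableSpace 𝒵] {a : ι → κ → ℝ} {ψ : κ → 𝒵 → ℝ} {g : ι → 𝒵 → ℝ} {M K c : ℝ}
    (hg : ∀ i, Measurable (g i)) (hψ : ∀ j, Measurable (ψ j)) (hK : 0 ≤ K) (hc : 0 ≤ c)
    (ha : ∀ i, ∑ j, |a i j| ≤ M) (hψK : ∀ j z, |ψ j z| ≤ K)
    (hinc : ∀ i k z, |g i z - g k z| ≤ c * |∑ j, a i j * ψ j z - ∑ j, a k j * ψ j z|)
    (hbd : ∀ i z, |g i z| ≤ c * |∑ j, a i j * ψ j z|) (n : ℕ) (ν : Fin n → Measure 𝒵)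
    [∀ l, IsProbabilityMeasure (ν l)] (v : κ → ℝ) :
    ∫⁻ w, ENNReal.ofReal (expSup fun i => ∑ j, a i j * v j
        + ∑ l, ((∫ z, g i z ∂(ν l)) - g i (w l))) ∂(Measure.pi ν)
      ≤ ENNReal.ofReal (2 * (∑ j, Real.cosh (M * v j))
          * Real.exp (n * ((2 * c * M * K) ^ 2 / 2))) := by
  have hM : 0 ≤ M := by
    obtain ⟨i⟩ := ‹Nonempty ι›
    exact (Finset.sum_nonneg fun j _ => abs_nonneg _).trans (ha i)
  -- The vector `v` must be general, since each removed observation shifts it by a multiple of `ψ`.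
  induction n generalizing v with
  | zero => simpa using ENNReal.ofReal_le_ofReal (expSup_linear_le ha v)
  | succ n ih =>
    set h : ι → 𝒵 → ℝ := fun i z => c * ∑ j, a i j * ψ j z with hh
    set σ : ℝ := (2 * c * M * K) ^ 2 / 2 with hσ
    set S : (Fin n → 𝒵) → ι → ℝ := fun w i => ∑ l : Fin n,
      ((∫ z, g i z ∂(ν l.succ)) - g i (w l)) with hS
    have hhm : ∀ i, Measurable (h i) := fun i => by
      simp only [hh]; fun_prop
    have hSm : ∀ i, Measurable fun w => S w i := fun i => by
      simp only [hS]; fun_prop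
    have hhC : ∀ i z, |h i z| ≤ c * (M * K) := fun i z => by
      simp only [hh]; rw [abs_mul, abs_of_nonneg hc]
      exact mul_le_mul_of_nonneg_left (abs_sum_mul_le hK (ha i) fun j => hψK j z) hc
    have hinc' : ∀ i k z, |g i z - g k z| ≤ |h i z - h k z| := fun i k z => by
      simp only [hh]; rw [← mul_sub, abs_mul, abs_of_nonneg hc]; exact hinc i k z
    have hbd' : ∀ i z, |g i z| ≤ |h i z| := fun i z => by
      simp only [hh]; rw [abs_mul, abs_of_nonneg hc]; exact hbd i z
    have hgC : ∀ i z, |g i z| ≤ c * (M * K) := fun i z => (hbd' i z).trans (hhC i z)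
    -- The dominating process is linear in the same coefficients `a i`, so adding it keeps the form
    -- required by the induction hypothesis.
    have shift : ∀ (s : ℝ) (z : 𝒵) (w : Fin n → 𝒵),
        (fun i => (∑ j, a i j * v j + S w i) + s * h i z)
          = fun i => ∑ j, a i j * (v j + s * c * ψ j z) + S w i := fun s z w => by
      funext i
      simp only [hh, mul_add, Finset.sum_add_distrib, Finset.mul_sum]
      rw [add_right_comm]; congr 2
      exact Finset.sum_congr rfl fun j _ => by ring
    have shiftp := shift 2
    have shiftm : ∀ (z : 𝒵) (w : Fin n → 𝒵),
        (fun i => (∑ j, a i j * v j + S w i) - 2 * h i z)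
          = fun i => ∑ j, a i j * (v j + (-2) * c * ψ j z) + S w i := fun z w => by
      rw [← shift]; funext i; ring
    set T : 𝒵 → (Fin n → 𝒵) → ℝ := fun z w =>
      (expSup (fun i => (∑ j, a i j * v j + S w i) + 2 * h i z)
        + expSup (fun i => (∑ j, a i j * v j + S w i) - 2 * h i z)) / 2 with hT
    have hTm : Measurable (Function.uncurry T) := by
      simp only [hT, Function.uncurry_def]
      refine ((measurable_expSup fun i => ?_).add (measurable_expSup fun i => ?_)).div_const 2
      · exact (((hSm i).comp measurable_snd).const_add _).add
          (((hhm i).comp measurable_fst).const_mul 2)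
      · exact (((hSm i).comp measurable_snd).const_add _).sub
          (((hhm i).comp measurable_fst).const_mul 2)
    -- Observation `0` is integrated first, with the others fixed, for the symmetrisation; the order
    -- is then exchanged so that it is fixed when the induction hypothesis is applied.
    have hmp := (measurePreserving_piFinSuccAbove ν 0).symm
    rw [← hmp.lintegral_comp_emb (MeasurableEquiv.measurableEmbedding _),
      lintegral_prod_symm]
    swap
    · refine Measurable.aemeasurable (Measurable.ennreal_ofReal (measurable_expSup fun i => ?_))
      have : Measurable fun w : Fin (n + 1) → 𝒵 =>
          ∑ j, a i j * v j + ∑ l, ((∫ z, g i z ∂(ν l)) - g i (w l)) := by fun_prop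
      exact this.comp (MeasurableEquiv.measurable _)
    have step : ∀ w : Fin n → 𝒵,
        ∫⁻ z, ENNReal.ofReal (expSup fun i => ∑ j, a i j * v j
          + ∑ l, ((∫ z, g i z ∂(ν l))
            - g i ((MeasurableEquiv.piFinSuccAbove (fun _ => 𝒵) 0).symm (z, w) l))) ∂(ν 0)
        ≤ ∫⁻ z, ENNReal.ofReal (T z w) ∂(ν 0) := by
      intro w
      obtain ⟨k, hk⟩ := Finite.exists_max fun i => |∑ j, a i j * v j + S w i|
      have e : ∀ z : 𝒵, (fun i => ∑ j, a i j * v j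
          + ∑ l, ((∫ z, g i z ∂(ν l))
            - g i ((MeasurableEquiv.piFinSuccAbove (fun _ => 𝒵) 0).symm (z, w) l)))
          = fun i => (∑ j, a i j * v j + S w i) + (∫ z, g i z ∂(ν 0)) - g i z := by
        intro z; funext i
        simp [MeasurableEquiv.piFinSuccAbove_symm_apply, Fin.insertNthEquiv,
          Fin.sum_univ_succ, hS]
        ring
      simp only [e]
      have hI : ∀ i, |∫ z, g i z ∂(ν 0)| ≤ c * (M * K) := fun i => by
        simpa using norm_integral_le_of_norm_le_const (μ := ν 0) (f := g i)
          (Filter.Eventually.of_forall fun z => hgC i z)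
      have b2 : ∀ i z, |2 * h i z| ≤ 2 * (c * (M * K)) := fun i z => by
        rw [abs_mul, abs_two]; linarith [hhC i z]
      rw [← ofReal_integral_eq_lintegral_ofReal, ← ofReal_integral_eq_lintegral_ofReal]
      · exact ENNReal.ofReal_le_ofReal
          (integral_expSup_symm_contraction (ν 0) _ hg hhm hhC hinc' hbd')
      · refine Integrable.div_const (Integrable.add ?_ ?_) 2
        · exact integrable_expSup _ (fun i => measurable_const.add ((hhm i).const_mul 2))
            fun z i => (abs_add_le _ _).trans (add_le_add (hk i) (b2 i z))
        · exact integrable_expSup _ (fun i => measurable_const.sub ((hhm i).const_mul 2))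
            fun z i => (abs_sub _ _).trans (add_le_add (hk i) (b2 i z))
      · refine Filter.Eventually.of_forall fun z => ?_
        exact div_nonneg (add_nonneg (expSup_pos _).le (expSup_pos _).le) zero_le_two
      · refine integrable_expSup _ (fun i => measurable_const.sub (hg i)) fun z i =>
          (abs_sub _ _).trans (add_le_add ((abs_add_le _ _).trans
            (add_le_add (hk i) (hI i))) (hgC i z))
      · exact Filter.Eventually.of_forall fun z => (expSup_pos _).le
    refine (lintegral_mono step).trans ?_
    rw [lintegral_lintegral_swap (hTm.comp measurable_swap).ennreal_ofReal.aemeasurable]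
    have inner : ∀ z, ∫⁻ w, ENNReal.ofReal (T z w) ∂(Measure.pi fun l : Fin n => ν l.succ)
        ≤ ENNReal.ofReal (2 * (∑ j, Real.cosh (M * v j)) * Real.exp ((n + 1 : ℕ) * σ)) := by
      intro z
      have ihp := ih (fun l => ν l.succ) (fun j => v j + 2 * c * ψ j z)
      have ihm := ih (fun l => ν l.succ) (fun j => v j + (-2) * c * ψ j z)
      have hsplit : ∀ w, ENNReal.ofReal (T z w)
          = ENNReal.ofReal (expSup fun i => ∑ j, a i j * (v j + 2 * c * ψ j z) + S w i) / 2
            + ENNReal.ofReal (expSup fun i => ∑ j, a i j * (v j + (-2) * c * ψ j z) + S w i) / 2 := by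
        intro w
        simp only [hT]
        rw [shiftp, shiftm, ENNReal.ofReal_div_of_pos two_pos,
          ENNReal.ofReal_add (expSup_pos _).le (expSup_pos _).le, ENNReal.add_div]
        simp
      have hm : ∀ v' : κ → ℝ, Measurable fun w =>
          ENNReal.ofReal (expSup fun i => ∑ j, a i j * v' j + S w i) := fun v' =>
        (measurable_expSup fun i => (hSm i).const_add _).ennreal_ofReal
      simp only [hsplit]
      rw [lintegral_add_left ((hm _).div_const 2)]
      simp only [div_eq_mul_inv]
      rw [lintegral_mul_const _ (hm _), lintegral_mul_const _ (hm _)]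
      refine (add_le_add (mul_le_mul_left ihp _) (mul_le_mul_left ihm _)).trans ?_
      have h2 : (2 : ℝ≥0∞)⁻¹ = ENNReal.ofReal (2⁻¹ : ℝ) := by
        rw [ENNReal.ofReal_inv_of_pos two_pos]; simp
      have hpos : ∀ v' : κ → ℝ, 0 ≤ 2 * (∑ j, Real.cosh (M * v' j)) * Real.exp (n * σ) := fun v' =>
        mul_nonneg (mul_nonneg zero_le_two (Finset.sum_nonneg fun j _ => (Real.cosh_pos _).le))
          (Real.exp_pos _).le
      rw [h2, ← ENNReal.ofReal_mul (hpos _), ← ENNReal.ofReal_mul (hpos _),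
        ← ENNReal.ofReal_add (mul_nonneg (hpos _) (by norm_num))
          (mul_nonneg (hpos _) (by norm_num))]
      refine ENNReal.ofReal_le_ofReal ?_
      have hsum : (∑ j, Real.cosh (M * (v j + 2 * c * ψ j z))
          + ∑ j, Real.cosh (M * (v j + (-2) * c * ψ j z))) / 2
            ≤ (∑ j, Real.cosh (M * v j)) * Real.exp σ := by
        rw [← Finset.sum_add_distrib, Finset.sum_div, Finset.sum_mul]
        refine Finset.sum_le_sum fun j _ => ?_
        have := cosh_add_add_cosh_sub_le (M * v j) (2 * c * M * ψ j z) (2 * c * M * K) (by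
          rw [abs_mul, abs_of_nonneg (by positivity)]
          exact mul_le_mul_of_nonneg_left (hψK j z) (by positivity))
        have e1 : M * (v j + 2 * c * ψ j z) = M * v j + 2 * c * M * ψ j z := by ring
        have e2 : M * (v j + (-2) * c * ψ j z) = M * v j - 2 * c * M * ψ j z := by ring
        rw [e1, e2]
        exact this
      have hexp : Real.exp ((n + 1 : ℕ) * σ) = Real.exp σ * Real.exp (n * σ) := by
        rw [← Real.exp_add]; push_cast; ring_nf
      rw [hexp]
      have := mul_le_mul_of_nonneg_right hsum (Real.exp_pos (n * σ)).le
      linarith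
    refine (lintegral_mono inner).trans ?_
    simp

/-- Tail bound for the supremum of a centred empirical process whose increments are dominated by
those of a linear process. -/
lemma measure_exists_lt_le {ι κ 𝒵 Ω : Type*} [Finite ι] [Nonempty ι] [Fintype κ] [Nonempty κ]
    [MeasurableSpace 𝒵] [MeasurableSpace Ω] {μ : Measure Ω} [IsProbabilityMeasure μ]
    {n : ℕ} {Z : Fin n → Ω → 𝒵} (hZ : ∀ l, Measurable (Z l)) (hind : iIndepFun Z μ)
    {a : ι → κ → ℝ} {ψ : κ → 𝒵 → ℝ} {g : ι → 𝒵 → ℝ} {M K c : ℝ}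
    (hg : ∀ i, Measurable (g i)) (hψ : ∀ j, Measurable (ψ j)) (hK : 0 ≤ K) (hc : 0 ≤ c)
    (ha : ∀ i, ∑ j, |a i j| ≤ M) (hψK : ∀ j z, |ψ j z| ≤ K)
    (hinc : ∀ i k z, |g i z - g k z| ≤ c * |∑ j, a i j * ψ j z - ∑ j, a k j * ψ j z|)
    (hbd : ∀ i z, |g i z| ≤ c * |∑ j, a i j * ψ j z|) (x : ℝ) :
    μ {ω | ∃ i, x < ∑ l, ((∫ ω', g i (Z l ω') ∂μ) - g i (Z l ω))}
      ≤ ENNReal.ofReal (2 * Fintype.card κ * Real.exp (n * ((2 * c * M * K) ^ 2 / 2) - x)) := by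
  have hprob : ∀ l, IsProbabilityMeasure (μ.map (Z l)) := fun l =>
    Measure.isProbabilityMeasure_map (hZ l).aemeasurable
  -- Starting from `v = 0`, every `cosh` equals `1` and the sum is the number of coordinates.
  have hbound := lintegral_expSup_pi_le hg hψ hK hc ha hψK hinc hbd n (fun l => μ.map (Z l)) 0
  rw [← (iIndepFun_iff_map_fun_eq_pi_map fun l => (hZ l).aemeasurable).1 hind] at hbound
  have hme : Measurable fun w : Fin n → 𝒵 => ENNReal.ofReal (expSup fun i =>
      ∑ j, a i j * (0 : κ → ℝ) j + ∑ l, ((∫ z, g i z ∂(μ.map (Z l))) - g i (w l))) :=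
    (measurable_expSup fun i => by fun_prop).ennreal_ofReal
  rw [lintegral_map hme (measurable_pi_lambda _ hZ)] at hbound
  have hmap : ∀ i l, ∫ z, g i z ∂(μ.map (Z l)) = ∫ ω, g i (Z l ω) ∂μ := fun i l =>
    integral_map (hZ l).aemeasurable (hg i).aestronglyMeasurable
  simp only [hmap, Pi.zero_apply, mul_zero, Finset.sum_const_zero, zero_add, Real.cosh_zero,
    Finset.sum_const, Finset.card_univ, nsmul_eq_mul, mul_one] at hbound
  have hmark := meas_ge_le_lintegral_div (μ := μ) (f := fun ω => ENNReal.ofReal (expSup fun i =>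
      ∑ l, ((∫ ω', g i (Z l ω') ∂μ) - g i (Z l ω))))
    ((measurable_expSup fun i => Finset.measurable_fun_sum _ fun l _ =>
      ((hg i).comp (hZ l)).const_sub _).ennreal_ofReal.aemeasurable)
    (ε := ENNReal.ofReal (Real.exp x)) (by simp [Real.exp_pos]) (by simp)
  refine (measure_mono ?_).trans (hmark.trans ?_)
  · rintro ω ⟨i, hi⟩
    exact ENNReal.ofReal_le_ofReal ((Real.exp_le_exp.2 hi.le).trans (exp_le_expSup
      (fun i => ∑ l, ((∫ ω', g i (Z l ω') ∂μ) - g i (Z l ω))) i))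
  · rw [Real.exp_sub, ← mul_div_assoc, ENNReal.ofReal_div_of_pos (Real.exp_pos x)]
    exact ENNReal.div_le_div_right hbound _

/-- With probability at least `1 - 1/p`, the supremum of the centred empirical process over an
`ℓ₁`-ball of radius `M` is at most of order `D M √(log p / n)`, for finitely many functions. -/
lemma measure_exists_lt_le_inv {ι 𝒵 Ω : Type*} [Finite ι] [Nonempty ι]
    [MeasurableSpace 𝒵] [MeasurableSpace Ω] {μ : Measure Ω} [IsProbabilityMeasure μ]
    {n p : ℕ} (hn : 0 < n) (hp : 2 ≤ p) {Z : Fin n → Ω → 𝒵} (hZ : ∀ l, Measurable (Z l))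
    (hind : iIndepFun Z μ) {a : ι → Fin p → ℝ} {ψ : Fin p → 𝒵 → ℝ} {g : ι → 𝒵 → ℝ} {M K D : ℝ}
    (hg : ∀ i, Measurable (g i)) (hψ : ∀ j, Measurable (ψ j)) (hK : 0 < K) (hD : 0 < D)
    (hM : 0 < M) (ha : ∀ i, ∑ j, |a i j| ≤ M) (hψK : ∀ j z, |ψ j z| ≤ K)
    (hinc : ∀ i k z, |g i z - g k z| ≤ D * |∑ j, a i j * ψ j z - ∑ j, a k j * ψ j z|)
    (hbd : ∀ i z, |g i z| ≤ D * |∑ j, a i j * ψ j z|) :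
    μ {ω | ∃ i, n * (5 * K * D * Real.sqrt (Real.log p / n) * M)
        < ∑ l, ((∫ ω', g i (Z l ω') ∂μ) - g i (Z l ω))} ≤ ENNReal.ofReal (1 / p) := by
  have : Nonempty (Fin p) := ⟨⟨0, by omega⟩⟩
  have hp0 : (0 : ℝ) < p := by positivity
  have hp2 : (2 : ℝ) ≤ p := by exact_mod_cast hp
  have hn0 : (0 : ℝ) < n := by positivity
  have hlog : 0 < Real.log p := Real.log_pos (by linarith)
  set r := Real.sqrt (Real.log p / n) with hr
  have hr0 : 0 < r := Real.sqrt_pos.2 (by positivity)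
  have hr2 : n * r ^ 2 = Real.log p := by
    rw [hr, Real.sq_sqrt (by positivity)]; field_simp
  -- Chernoff parameter: the moment exponent becomes `n * (2 * r) ^ 2 / 2 = 2 * log p`, against the
  -- threshold `5 * log p`. The tail is thus `2 * p * p⁻³`, at most `1 / p` because `p ≥ 2`.
  set t : ℝ := r / (K * D * M) with ht
  have ht0 : 0 < t := by positivity
  have htM : t * (K * D * M) = r := by rw [ht]; field_simp
  have key := measure_exists_lt_le (μ := μ) hZ hind (a := a) (ψ := ψ)
    (g := fun i z => t * g i z) (M := M) (K := K) (c := t * D)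
    (fun i => (hg i).const_mul t) hψ hK.le (by positivity) ha hψK
    (fun i k z => by
      rw [← mul_sub, abs_mul, abs_of_pos ht0, mul_assoc]
      exact mul_le_mul_of_nonneg_left (hinc i k z) ht0.le)
    (fun i z => by
      rw [abs_mul, abs_of_pos ht0, mul_assoc]
      exact mul_le_mul_of_nonneg_left (hbd i z) ht0.le) (5 * Real.log p)
  refine (measure_mono ?_).trans (key.trans (ENNReal.ofReal_le_ofReal ?_))
  · rintro ω ⟨i, hi⟩
    refine ⟨i, ?_⟩
    have h1 := mul_lt_mul_of_pos_left hi ht0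
    have h2 : t * (n * (5 * K * D * r * M)) = 5 * Real.log p := by
      rw [← hr2]; linear_combination (5 * n * r) * htM
    rw [h2, Finset.mul_sum] at h1
    simpa only [integral_const_mul, mul_sub] using h1
  · have h3 : n * ((2 * (t * D) * M * K) ^ 2 / 2) - 5 * Real.log p = -(3 * Real.log p) := by
      have : 2 * (t * D) * M * K = 2 * r := by linear_combination 2 * htM
      rw [this, ← hr2]; ring
    have h4 : Real.exp (-(3 * Real.log p)) = ((p : ℝ) ^ 3)⁻¹ := by
      have h : (3 : ℝ) * Real.log p = Real.log ((p : ℝ) ^ 3) := by rw [Real.log_pow]; norm_num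
      rw [h, Real.exp_neg, Real.exp_log (by positivity)]
    rw [h3, h4, Fintype.card_fin, ← div_eq_mul_inv, div_le_div_iff₀ (by positivity) hp0]
    nlinarith [mul_le_mul_of_nonneg_left hp2 (by positivity : (0 : ℝ) ≤ p ^ 2)]

/-- The countable version of `measure_exists_lt_le_inv`. -/
lemma measure_exists_nat_lt_le_inv {𝒵 Ω : Type*}
    [MeasurableSpace 𝒵] [MeasurableSpace Ω] {μ : Measure Ω} [IsProbabilityMeasure μ]
    {n p : ℕ} (hn : 0 < n) (hp : 2 ≤ p) {Z : Fin n → Ω → 𝒵} (hZ : ∀ l, Measurable (Z l))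
    (hind : iIndepFun Z μ) {a : ℕ → Fin p → ℝ} {ψ : Fin p → 𝒵 → ℝ} {g : ℕ → 𝒵 → ℝ} {M K D : ℝ}
    (hg : ∀ i, Measurable (g i)) (hψ : ∀ j, Measurable (ψ j)) (hK : 0 < K) (hD : 0 < D)
    (hM : 0 < M) (ha : ∀ i, ∑ j, |a i j| ≤ M) (hψK : ∀ j z, |ψ j z| ≤ K)
    (hinc : ∀ i k z, |g i z - g k z| ≤ D * |∑ j, a i j * ψ j z - ∑ j, a k j * ψ j z|)
    (hbd : ∀ i z, |g i z| ≤ D * |∑ j, a i j * ψ j z|) :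
    μ {ω | ∃ i, n * (5 * K * D * Real.sqrt (Real.log p / n) * M)
        < ∑ l, ((∫ ω', g i (Z l ω') ∂μ) - g i (Z l ω))} ≤ ENNReal.ofReal (1 / p) := by
  set x := n * (5 * K * D * Real.sqrt (Real.log p / n) * M) with hx
  set s : ℕ → Set Ω := fun m => {ω | ∃ i : Fin (m + 1),
    x < ∑ l, ((∫ ω', g i (Z l ω') ∂μ) - g i (Z l ω))} with hs
  have hmono : Monotone s := by
    rintro m m' hm ω ⟨i, hi⟩
    exact ⟨⟨i, by omega⟩, hi⟩
  have hun : {ω | ∃ i, x < ∑ l, ((∫ ω', g i (Z l ω') ∂μ) - g i (Z l ω))} = ⋃ m, s m := by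
    ext ω
    simp only [hs, Set.mem_ofPred_eq, Set.mem_iUnion]
    constructor
    · rintro ⟨i, hi⟩
      exact ⟨i, ⟨i, by omega⟩, hi⟩
    · rintro ⟨m, i, hi⟩
      exact ⟨i, hi⟩
  rw [hun, hmono.measure_iUnion]
  exact iSup_le fun m => measure_exists_lt_le_inv hn hp hZ hind (a := fun i : Fin (m + 1) => a i)
    (g := fun i : Fin (m + 1) => g i) (fun i => hg i) hψ hK hD hM (fun i => ha i) hψK
    (fun i k => hinc i k) fun i => hbd i

/-- The version of `measure_exists_lt_le_inv` for functions indexed by a set of vectors: a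
measurable event of probability at least `1 - 1/p` on which the bound holds uniformly. -/
lemma exists_measurableSet_forall_le {𝒵 Ω : Type*}
    [MeasurableSpace 𝒵] [MeasurableSpace Ω] {μ : Measure Ω} [IsProbabilityMeasure μ]
    {n p : ℕ} (hn : 0 < n) (hp : 2 ≤ p) {Z : Fin n → Ω → 𝒵} (hZ : ∀ l, Measurable (Z l))
    (hind : iIndepFun Z μ) {A : Set (Fin p → ℝ)} (h0 : (0 : Fin p → ℝ) ∈ A)
    {ψ : Fin p → 𝒵 → ℝ} {g : (Fin p → ℝ) → 𝒵 → ℝ} {M K D : ℝ}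
    (hg : ∀ a ∈ A, Measurable (g a)) (hψ : ∀ j, Measurable (ψ j)) (hK : 0 < K) (hD : 0 < D)
    (hM : 0 < M) (ha : ∀ a ∈ A, ∑ j, |a j| ≤ M) (hψK : ∀ j z, |ψ j z| ≤ K)
    (hinc : ∀ a ∈ A, ∀ b ∈ A, ∀ z,
      |g a z - g b z| ≤ D * |∑ j, a j * ψ j z - ∑ j, b j * ψ j z|)
    (hg0 : ∀ z, g 0 z = 0) :
    ∃ E : Set Ω, MeasurableSet E ∧ ENNReal.ofReal (1 - 1 / p) ≤ μ E ∧ ∀ ω ∈ E, ∀ a ∈ A,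
      (1 / (n : ℝ)) * ∑ l, ((∫ ω', g a (Z l ω') ∂μ) - g a (Z l ω))
        ≤ 5 * K * D * Real.sqrt (Real.log p / n) * M := by
  have hp0 : (0 : ℝ) < p := by positivity
  have hn0 : (0 : ℝ) < n := by positivity
  set x := 5 * K * D * Real.sqrt (Real.log p / n) * M with hx
  have hne : Nonempty A := ⟨⟨0, h0⟩⟩
  set q : ℕ → A := TopologicalSpace.denseSeq A with hq
  have hbd : ∀ a ∈ A, ∀ z, |g a z| ≤ D * |∑ j, a j * ψ j z| := fun a haA z => by
    simpa [hg0 z] using hinc a haA 0 h0 z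
  set V : A → Ω → ℝ := fun a ω => ∑ l, ((∫ ω', g a (Z l ω') ∂μ) - g a (Z l ω)) with hV
  have hVm : ∀ a, Measurable (V a) := fun a => by
    simp only [hV]
    exact Finset.measurable_fun_sum _ fun l _ => ((hg a a.2).comp (hZ l)).const_sub _
  have hcont : ∀ z, Continuous fun a : A => g a z := by
    intro z
    have hlin : Continuous fun a : A => ∑ j, (a : Fin p → ℝ) j * ψ j z :=
      continuous_finsetSum _ fun j _ =>
        ((continuous_apply j).comp continuous_subtype_val).mul_const _
    rw [continuous_iff_continuousAt]
    intro b
    rw [ContinuousAt, tendsto_iff_norm_sub_tendsto_zero]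
    have h1 : Filter.Tendsto (fun a : A => D * |∑ j, (a : Fin p → ℝ) j * ψ j z
        - ∑ j, (b : Fin p → ℝ) j * ψ j z|) (nhds b) (nhds 0) := by
      have : Continuous fun a : A => D * |∑ j, (a : Fin p → ℝ) j * ψ j z
        - ∑ j, (b : Fin p → ℝ) j * ψ j z| :=
        (hlin.sub continuous_const).abs.const_mul D
      simpa using this.tendsto b
    exact squeeze_zero (fun a => norm_nonneg _) (fun a => hinc a a.2 b b.2 z) h1
  -- Dominated convergence handles the means; the increment bound handles the sample values. Hence a
  -- dense sequence in `A` controls the whole index set.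
  have hVc : ∀ ω, Continuous fun a => V a ω := by
    intro ω
    simp only [hV]
    refine continuous_finsetSum _ fun l _ => Continuous.sub ?_ (hcont _)
    refine continuous_of_dominated (bound := fun _ => D * (M * K))
      (fun a => ((hg a a.2).comp (hZ l)).aestronglyMeasurable)
      (fun a => Filter.Eventually.of_forall fun ω => ?_) (integrable_const _)
      (Filter.Eventually.of_forall fun ω => hcont _)
    exact (hbd a a.2 _).trans (mul_le_mul_of_nonneg_left
      (abs_sum_mul_le hK.le (ha a a.2) fun j => hψK j _) hD.le)
  have hbad := measure_exists_nat_lt_le_inv hn hp hZ hind (a := fun k => (q k : Fin p → ℝ))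
    (g := fun k => g (q k)) (fun k => hg _ (q k).2) hψ hK hD hM (fun k => ha _ (q k).2) hψK
    (fun i k => hinc _ (q i).2 _ (q k).2) (fun k => hbd _ (q k).2)
  set B : Set Ω := {ω | ∃ k, n * x < V (q k) ω} with hB
  have hBm : MeasurableSet B := by
    have : B = ⋃ k, {ω | n * x < V (q k) ω} := by ext ω; simp [hB]
    rw [this]
    exact MeasurableSet.iUnion fun k => measurableSet_lt measurable_const (hVm _)
  refine ⟨Bᶜ, hBm.compl, ?_, fun ω hω a haA => ?_⟩
  · rw [prob_compl_eq_one_sub hBm, ENNReal.ofReal_sub _ (by positivity), ENNReal.ofReal_one]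
    exact tsub_le_tsub_left hbad 1
  · have hall : ∀ a : A, V a ω ≤ n * x := by
      have hd : Dense (Set.range q) := TopologicalSpace.denseRange_denseSeq A
      have hcl : IsClosed {a : A | V a ω ≤ n * x} := isClosed_le (hVc ω) continuous_const
      intro a
      have hsub : Set.range q ⊆ {a : A | V a ω ≤ n * x} := by
        rintro _ ⟨k, rfl⟩
        by_contra hk
        exact hω ⟨k, not_le.1 hk⟩
      exact hcl.closure_subset_iff.2 hsub (hd a)
    have h := hall ⟨a, haA⟩
    rw [one_div, inv_mul_le_iff₀ hn0]
    exact h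


/-! ### Norm inequalities for sparse vectors. -/

section Norms

variable {p : ℕ}

lemma l1norm_nonneg (β : Fin p → ℝ) : 0 ≤ l1norm β := Finset.sum_nonneg fun _ _ => abs_nonneg _

lemma l2norm_nonneg (β : Fin p → ℝ) : 0 ≤ l2norm β := Real.sqrt_nonneg _

lemma l2norm_sq (β : Fin p → ℝ) : l2norm β ^ 2 = ∑ j, β j ^ 2 :=
  Real.sq_sqrt (Finset.sum_nonneg fun _ _ => sq_nonneg _)

lemma l1norm_smul (t : ℝ) (β : Fin p → ℝ) : l1norm (t • β) = |t| * l1norm β := by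
  simp [l1norm, abs_mul, Finset.mul_sum]

lemma l1norm_restr_add (S : Finset (Fin p)) (δ : Fin p → ℝ) :
    l1norm (restr S δ) + l1norm (restr Sᶜ δ) = l1norm δ := by
  simp only [l1norm, ← Finset.sum_add_distrib]
  refine Finset.sum_congr rfl fun j _ => ?_
  by_cases h : j ∈ S <;> simp [restr, h]

lemma l1norm_restr_le (S : Finset (Fin p)) (δ : Fin p → ℝ) :
    l1norm (restr S δ) ≤ Real.sqrt S.card * l2norm (restr S δ) := by
  have h1 : l1norm (restr S δ) = ∑ j ∈ S, 1 * |δ j| := by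
    simp [l1norm, restr, apply_ite abs, Finset.sum_ite_mem]
  have h2 : l2norm (restr S δ) = Real.sqrt (∑ j ∈ S, |δ j| ^ 2) := by
    simp [l2norm, restr, ite_pow, Finset.sum_ite_mem]
  rw [h1, h2]
  simpa using Real.sum_mul_le_sqrt_mul_sqrt S (fun _ => (1 : ℝ)) (fun j => |δ j|)

lemma restr_supp (β : Fin p → ℝ) : restr (supp β) β = β := by
  funext j
  by_cases h : β j = 0 <;> simp [restr, supp, h]

lemma restr_sub (S : Finset (Fin p)) (β b : Fin p → ℝ) :
    restr S β - restr S b = restr S (β - b) := by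
  funext j
  by_cases h : j ∈ S <;> simp [restr, h]

/-- Off the support of `βs` the coordinates of `β` and of the error agree, which gives the negative
term; on the support it is the triangle inequality. -/
lemma l1norm_sub_l1norm_le (βs β : Fin p → ℝ) :
    l1norm βs - l1norm β
      ≤ l1norm (restr (supp βs) (β - βs)) - l1norm (restr (supp βs)ᶜ (β - βs)) := by
  simp only [l1norm, ← Finset.sum_sub_distrib]
  refine Finset.sum_le_sum fun j _ => ?_
  by_cases h : βs j = 0
  · simp [restr, supp, h]
  · simp only [restr, supp, Finset.mem_filter, Finset.mem_univ, true_and, ne_eq, h,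
      not_false_eq_true, if_true, Finset.mem_compl, not_true_eq_false, if_false, abs_zero, sub_zero,
      Pi.sub_apply]
    have := abs_sub_abs_le_abs_sub (βs j) (β j)
    rwa [abs_sub_comm] at this

/-- Expansion of the square on the support, with Cauchy-Schwarz for the cross term. The retained
negative square becomes the ridge term on the left of the oracle inequality. -/
lemma l2norm_sq_sub_le (βs β : Fin p → ℝ) :
    l2norm βs ^ 2 - l2norm β ^ 2
      ≤ 2 * l2norm βs * l2norm (restr (supp βs) (β - βs))
        - l2norm (restr (supp βs) (β - βs)) ^ 2 := by
  set δ := restr (supp βs) (β - βs) with hδ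
  have hcs : ∑ j, (-βs j) * δ j ≤ l2norm βs * l2norm δ := by
    have := Real.sum_mul_le_sqrt_mul_sqrt Finset.univ (fun j => -βs j) δ
    simpa [l2norm] using this
  have hle : l2norm βs ^ 2 - l2norm β ^ 2 ≤ 2 * ∑ j, (-βs j) * δ j - l2norm δ ^ 2 := by
    rw [l2norm_sq, l2norm_sq, l2norm_sq, Finset.mul_sum, ← Finset.sum_sub_distrib,
      ← Finset.sum_sub_distrib]
    refine Finset.sum_le_sum fun j _ => ?_
    by_cases h : βs j = 0
    · simp [hδ, restr, supp, h, sq_nonneg]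
    · simp only [hδ, restr, supp, Finset.mem_filter, Finset.mem_univ, true_and, ne_eq, h,
        not_false_eq_true, if_true, Pi.sub_apply]
      nlinarith
  linarith

lemma l1norm_convex (t : ℝ) (h0 : 0 ≤ t) (h1 : t ≤ 1) (β b : Fin p → ℝ) :
    l1norm (t • β + (1 - t) • b) ≤ t * l1norm β + (1 - t) * l1norm b := by
  simp only [l1norm, Finset.mul_sum, ← Finset.sum_add_distrib]
  refine Finset.sum_le_sum fun j _ => ?_
  simp only [Pi.add_apply, Pi.smul_apply, smul_eq_mul]
  refine (abs_add_le _ _).trans ?_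
  rw [abs_mul, abs_mul, abs_of_nonneg h0, abs_of_nonneg (sub_nonneg.2 h1)]

lemma l2norm_sq_convex (t : ℝ) (h0 : 0 ≤ t) (h1 : t ≤ 1) (β b : Fin p → ℝ) :
    l2norm (t • β + (1 - t) • b) ^ 2 ≤ t * l2norm β ^ 2 + (1 - t) * l2norm b ^ 2 := by
  simp only [l2norm_sq, Finset.mul_sum, ← Finset.sum_add_distrib]
  refine Finset.sum_le_sum fun j _ => ?_
  simp only [Pi.add_apply, Pi.smul_apply, smul_eq_mul]
  nlinarith [mul_nonneg (mul_nonneg h0 (sub_nonneg.2 h1)) (sq_nonneg (β j - b j))]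

variable {𝒳 : Type*} {F : Submodule ℝ (𝒳 → ℝ)} (ψ : Fin p → F)

lemma lin_apply (β : Fin p → ℝ) (x : 𝒳) :
    (lin ψ β : 𝒳 → ℝ) x = ∑ j, β j * (ψ j : 𝒳 → ℝ) x := by
  simp [lin]

lemma lin_add (β b : Fin p → ℝ) : lin ψ (β + b) = lin ψ β + lin ψ b := by
  simp [lin, add_smul, Finset.sum_add_distrib]

lemma lin_smul (t : ℝ) (β : Fin p → ℝ) : lin ψ (t • β) = t • lin ψ β := by
  simp [lin, mul_smul, Finset.smul_sum]

lemma lin_sub (β b : Fin p → ℝ) : lin ψ (β - b) = lin ψ β - lin ψ b := by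
  rw [sub_eq_add_neg, ← neg_one_smul ℝ b, lin_add, lin_smul]
  module

end Norms

/-! ### Deterministic oracle inequality. -/

section Deterministic

variable {𝒳 : Type*} {F : Submodule ℝ (𝒳 → ℝ)} {p : ℕ} {ψ : Fin p → F} {N : Seminorm ℝ F}
  {R Xi : F → ℝ} {f0 : F} {Φ : Set (Fin p → ℝ)} {βs : Fin p → ℝ} {l0 l1 l2 M v H : ℝ}

/-- The oracle inequality for a vector in the `ℓ₁`-ball of radius `M` around `βs` whose penalised
empirical risk is at most that of `βs`. -/
lemma oracle_inequality_of_mem_ball (hl0 : 0 < l0) (hl1 : 8 * l0 ≤ l1) (hl2 : 0 ≤ l2)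
    (hv : 0 ≤ v) (hβs : βs ∈ Φ) (hM : 0 ≤ M)
    (hV : ∀ β ∈ Φ, l1norm (β - βs) ≤ M →
      (Xi (lin ψ β) - Xi (lin ψ βs)) - (R (lin ψ β) - R (lin ψ βs)) ≤ l0 * M)
    (hN : ∀ β ∈ Φ, l1norm (β - βs) ≤ M → v * N (lin ψ β - f0) ≤ Xi (lin ψ β) + H)
    (hφ : ∀ δ, l1norm (restr (supp βs)ᶜ δ)
        ≤ coneConst l1 l2 (supp βs) βs * l2norm (restr (supp βs) δ) →
      (4 * l1 * Real.sqrt ((supp βs).card : ℝ) + 4 * l2 * l2norm βs)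
        * l2norm (restr (supp βs) δ) ≤ v * N (lin ψ δ))
    (hH : 0 ≤ H) (hXi : ∀ f, 0 ≤ Xi f) (hΔ : 3 / 2 * Xi (lin ψ βs) + H ≤ l0 * M)
    {β : Fin p → ℝ} (hβ : β ∈ Φ) (hβM : l1norm (β - βs) ≤ M)
    (hbasic : R (lin ψ β) + l1 * l1norm β + l2 * l2norm β ^ 2
      ≤ R (lin ψ βs) + l1 * l1norm βs + l2 * l2norm βs ^ 2) :
    Xi (lin ψ β) + l1 * l1norm (β - βs) + l2 * l2norm (restr (supp βs) (β - βs)) ^ 2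
      ≤ 4 * (l0 * M) := by
  have hl1' : 0 < l1 := by linarith
  set δ := β - βs with hδ
  have hsplit := l1norm_restr_add (supp βs) δ
  have hl1d := mul_le_mul_of_nonneg_left (l1norm_sub_l1norm_le βs β) hl1'.le
  have hl2d := mul_le_mul_of_nonneg_left (l2norm_sq_sub_le βs β) hl2
  have hds := l1norm_restr_le (supp βs) δ
  have hVβ := hV β hβ hβM
  rw [← hδ] at hl1d hl2d
  set ds := l1norm (restr (supp βs) δ)
  set dc := l1norm (restr (supp βs)ᶜ δ)
  set d2 := l2norm (restr (supp βs) δ) with hd2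
  set q := Real.sqrt ((supp βs).card : ℝ) with hq
  have hds' := mul_le_mul_of_nonneg_left hds hl1'.le
  rw [← hsplit]
  have hmain : Xi (lin ψ β) + l1 * dc + l2 * d2 ^ 2
      ≤ l0 * M + Xi (lin ψ βs) + (l1 * q + 2 * l2 * l2norm βs) * d2 := by
    linarith
  have hl2d2 : 0 ≤ l2 * d2 ^ 2 := by positivity
  have hl1n : 0 ≤ l1 * (ds + dc) :=
    mul_nonneg hl1'.le (add_nonneg (l1norm_nonneg _) (l1norm_nonneg _))
  have hl2n : 0 ≤ l2 * l2norm βs * d2 :=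
    mul_nonneg (mul_nonneg hl2 (l2norm_nonneg _)) (l2norm_nonneg _)
  have hXβ0 := hXi (lin ψ β)
  have hXs0 := hXi (lin ψ βs)
  -- If the condition fails, the left side of the goal is at most `2 * (l0 * M + Ξ(f*))`, and `Ξ(f*)
  -- ≤ 2/3 * (l0 * M)` keeps it below `4 * (l0 * M)`. If it holds, the basic inequality gives the
  -- cone condition, with the factor `1 + 2 = 3` of `coneConst`.
  by_cases hcase : l0 * M + Xi (lin ψ βs) ≤ 2 * ((l1 * q + 2 * l2 * l2norm βs) * d2)
  · have hXβ : v * N (lin ψ β - f0) ≤ Xi (lin ψ β) + H := hN β hβ hβM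
    have hXs : v * N (lin ψ βs - f0) ≤ Xi (lin ψ βs) + H :=
      hN βs hβs (by simpa [l1norm] using hM)
    have htri : N (lin ψ δ) ≤ N (lin ψ β - f0) + N (lin ψ βs - f0) := by
      have : lin ψ δ = (lin ψ β - f0) - (lin ψ βs - f0) := by rw [hδ, lin_sub]; abel
      rw [this]; exact map_sub_le_add N _ _
    have htri' := mul_le_mul_of_nonneg_left htri hv
    have hcone : dc ≤ coneConst l1 l2 (supp βs) βs * d2 := by
      have e : l1 * (coneConst l1 l2 (supp βs) βs * d2)
          = 3 * ((l1 * q + 2 * l2 * l2norm βs) * d2) := by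
        rw [coneConst, restr_supp, ← hq]; field_simp
      refine le_of_mul_le_mul_left ?_ hl1'
      rw [e]; linarith
    -- Half of this bound, combined with the triangle inequality and the two margin bounds, absorbs
    -- the error term: `Ξ(f_β) / 2` moves left and `l0 * M + 3/2 * Ξ(f*) + H ≤ 2 * (l0 * M)`
    -- remains. Doubling gives the claim.
    have := hφ δ hcone
    rw [← hd2] at this
    linarith
  · linarith

/-- The oracle inequality for the elastic net, given a bound on the empirical process over the
`ℓ₁`-ball of radius `M` around the oracle. -/
lemma oracle_inequality_of_isMin (hl0 : 0 < l0) (hl1 : 8 * l0 ≤ l1) (hl2 : 0 ≤ l2)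
    (hv : 0 ≤ v) (hΦ : Convex ℝ Φ) (hβs : βs ∈ Φ) (hM : 0 < M) (hR : ConvexOn ℝ Set.univ R)
    (hV : ∀ β ∈ Φ, l1norm (β - βs) ≤ M →
      (Xi (lin ψ β) - Xi (lin ψ βs)) - (R (lin ψ β) - R (lin ψ βs)) ≤ l0 * M)
    (hN : ∀ β ∈ Φ, l1norm (β - βs) ≤ M → v * N (lin ψ β - f0) ≤ Xi (lin ψ β) + H)
    (hφ : ∀ δ, l1norm (restr (supp βs)ᶜ δ)
        ≤ coneConst l1 l2 (supp βs) βs * l2norm (restr (supp βs) δ) →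
      (4 * l1 * Real.sqrt ((supp βs).card : ℝ) + 4 * l2 * l2norm βs)
        * l2norm (restr (supp βs) δ) ≤ v * N (lin ψ δ))
    (hH : 0 ≤ H) (hXi : ∀ f, 0 ≤ Xi f) (hΔ : 3 / 2 * Xi (lin ψ βs) + H ≤ l0 * M)
    {b : Fin p → ℝ} (hb : b ∈ Φ)
    (hmin : R (lin ψ b) + l1 * l1norm b + l2 * l2norm b ^ 2
      ≤ R (lin ψ βs) + l1 * l1norm βs + l2 * l2norm βs ^ 2) :
    Xi (lin ψ b) + l1 * l1norm (b - βs) + l2 * l2norm (restr (supp βs) (b - βs)) ^ 2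
      ≤ 4 * (l0 * M) := by
  have hl1' : 0 < l1 := by linarith
  refine oracle_inequality_of_mem_ball hl0 hl1 hl2 hv hβs hM.le hV hN hφ hH hXi hΔ hb ?_ hmin
  set x := l1norm (b - βs) with hx
  have hx0 : 0 ≤ x := l1norm_nonneg _
  -- The point `t • b + (1 - t) • βs` lies in the ball whatever the size of `x`, and by convexity
  -- its penalised risk does not exceed that of `βs`.
  set t := M / (M + x) with ht
  have ht0 : 0 < t := by positivity
  have ht1 : t ≤ 1 := (div_le_one (by positivity)).2 (by linarith)
  set β := t • b + (1 - t) • βs with hβ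
  have hβΦ : β ∈ Φ := hΦ hb hβs ht0.le (sub_nonneg.2 ht1) (by ring)
  have hδ : β - βs = t • (b - βs) := by
    rw [hβ]; module
  have hnorm : l1norm (β - βs) = t * x := by rw [hδ, l1norm_smul, abs_of_pos ht0]
  have htx : t * (M + x) = M := by rw [ht]; field_simp
  have htxM : t * x ≤ M := by nlinarith
  have hlin : lin ψ β = t • lin ψ b + (1 - t) • lin ψ βs := by
    rw [hβ, lin_add, lin_smul, lin_smul]
  have hRβ : R (lin ψ β) ≤ t * R (lin ψ b) + (1 - t) * R (lin ψ βs) := by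
    rw [hlin]
    simpa using hR.2 (Set.mem_univ _) (Set.mem_univ _) ht0.le (sub_nonneg.2 ht1) (by ring)
  have h1 := mul_le_mul_of_nonneg_left (l1norm_convex t ht0.le ht1 b βs) hl1'.le
  have h2 := mul_le_mul_of_nonneg_left (l2norm_sq_convex t ht0.le ht1 b βs) hl2
  have h3 := mul_le_mul_of_nonneg_left hmin ht0.le
  have key := oracle_inequality_of_mem_ball hl0 hl1 hl2 hv hβs hM.le hV hN hφ hH hXi hΔ hβΦ
    (hnorm.trans_le htxM) (by rw [← hβ] at h1 h2; linarith)
  have hX0 := hXi (lin ψ β)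
  have hl2n : 0 ≤ l2 * l2norm (restr (supp βs) (β - βs)) ^ 2 := by positivity
  -- The factor `8` beats the `4` of the inequality in the ball, so the intermediate point is within
  -- `M / 2` of `βs`; for this choice of `t` that means `x ≤ M`.
  have h4 : 8 * l0 * (t * x) ≤ l1 * (t * x) := mul_le_mul_of_nonneg_right hl1 (by positivity)
  rw [hnorm] at key
  have h5 : l0 * (2 * (t * x)) ≤ l0 * M := by linarith
  have h6 : 2 * (t * x) ≤ M := le_of_mul_le_mul_left h5 hl0
  have h7 : t * x ≤ t * M := by linarith
  exact le_of_mul_le_mul_left h7 ht0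

end Deterministic

/-! ### Conjugate, restricted eigenvalue and recurring events. -/

/-- The Fenchel-Young inequality, with a real left side so that it can be combined with the margin
condition. -/
lemma le_conj (G : ℝ → ℝ) {v : ℝ≥0∞} (hv : v ≠ ⊤) {u : ℝ} (hu : 0 ≤ u) :
    ((u * v.toReal - G u : ℝ) : EReal) ≤ conj G v := by
  lift v to ℝ≥0 using hv
  lift u to ℝ≥0 using hu
  refine le_trans (le_of_eq ?_) (le_iSup (fun u : ℝ≥0 =>
    (((u : ℝ≥0∞) * v : ℝ≥0∞) : EReal) - ((G (u : ℝ) : ℝ) : EReal)) u)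
  rw [← ENNReal.coe_mul, EReal.coe_nnreal_eq_coe_real]
  simp [EReal.coe_sub]

lemma conj_nonneg {G : ℝ → ℝ} (hG : G 0 = 0) {v : ℝ≥0∞} : 0 ≤ conj G v := by
  refine le_trans (le_of_eq ?_) (le_iSup (fun u : ℝ≥0 =>
    (((u : ℝ≥0∞) * v : ℝ≥0∞) : EReal) - ((G (u : ℝ) : ℝ) : EReal)) 0)
  simp [hG]

/-- Any cone vector with nonzero restriction to the support is a competitor in the infimum, which
also makes `phi` finite. The value `phi = ⊤` can only meet a zero restriction, where the claim is
trivial. -/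
lemma mul_l2norm_le_of_cone {𝒳 : Type*} {F : Submodule ℝ (𝒳 → ℝ)} {p : ℕ} {N : Seminorm ℝ F}
    {ψ : Fin p → F} {l1 l2 : ℝ} {β : Fin p → ℝ} (hφ : 0 < phi N ψ l1 l2 β) {a : ℝ} (ha : 0 ≤ a)
    {δ : Fin p → ℝ} (hδ : l1norm (restr (supp β)ᶜ δ)
      ≤ coneConst l1 l2 (supp β) β * l2norm (restr (supp β) δ)) :
    a * l2norm (restr (supp β) δ)
      ≤ (ENNReal.ofReal a / phi N ψ l1 l2 β).toReal * N (lin ψ δ) := by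
  set d := l2norm (restr (supp β) δ) with hd
  have hd0 : 0 ≤ d := l2norm_nonneg _
  rcases hd0.eq_or_lt with h | h
  · rw [← h, mul_zero]
    exact mul_nonneg ENNReal.toReal_nonneg (apply_nonneg N _)
  have hδ0 : δ ≠ 0 := by
    rintro rfl
    simp [hd, restr, l2norm] at h
  have hle : phiSq N ψ l1 l2 (supp β) β ≤ ENNReal.ofReal (N (lin ψ δ) ^ 2 / d ^ 2) :=
    iInf_le_of_le δ (iInf_le_of_le hδ0 (iInf_le_of_le hδ le_rfl))
  have hle' : phi N ψ l1 l2 β ≤ ENNReal.ofReal (N (lin ψ δ) / d) := by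
    refine (ENNReal.rpow_le_rpow hle (by norm_num)).trans (le_of_eq ?_)
    have hnn : 0 ≤ N (lin ψ δ) / d := div_nonneg (apply_nonneg N _) hd0
    rw [← div_pow, ENNReal.ofReal_rpow_of_nonneg (sq_nonneg _) (by norm_num),
      ← Real.sqrt_eq_rpow, Real.sqrt_sq hnn]
  have htop : phi N ψ l1 l2 β ≠ ⊤ := ne_top_of_le_ne_top ENNReal.ofReal_ne_top hle'
  have hpos : 0 < (phi N ψ l1 l2 β).toReal := ENNReal.toReal_pos hφ.ne' htop
  have hle2 : (phi N ψ l1 l2 β).toReal ≤ N (lin ψ δ) / d :=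
    ENNReal.toReal_le_of_le_ofReal (div_nonneg (apply_nonneg N _) hd0) hle'
  rw [le_div_iff₀ h] at hle2
  rw [ENNReal.toReal_div, ENNReal.toReal_ofReal ha, div_mul_eq_mul_div, le_div_iff₀ hpos]
  calc _ = a * ((phi N ψ l1 l2 β).toReal * d) := by ring
    _ ≤ _ := mul_le_mul_of_nonneg_left hle2 ha

/-- A sequence of events of probability at least `c` occurs infinitely often with probability at
least `c`. -/
lemma exists_measurableSet_frequently {Ω : Type*} [MeasurableSpace Ω] {μ : Measure Ω}
    [IsFiniteMeasure μ] {E : ℕ → Set Ω} (hE : ∀ k, MeasurableSet (E k)) {c : ℝ≥0∞}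
    (hc : ∀ k, c ≤ μ (E k)) :
    ∃ A, MeasurableSet A ∧ c ≤ μ A ∧ ∀ ω ∈ A, ∀ m, ∃ k, m ≤ k ∧ ω ∈ E k := by
  set B : ℕ → Set Ω := fun m => ⋃ k, ⋃ _ : m ≤ k, E k with hB
  have hBm : ∀ m, MeasurableSet (B m) := fun m =>
    MeasurableSet.iUnion fun k => MeasurableSet.iUnion fun _ => hE k
  have hanti : Antitone B := by
    intro m m' hm ω hω
    simp only [hB, Set.mem_iUnion] at hω ⊢
    obtain ⟨k, hk, h⟩ := hω
    exact ⟨k, hm.trans hk, h⟩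
  refine ⟨⋂ m, B m, MeasurableSet.iInter hBm, ?_, fun ω hω m => ?_⟩
  · rw [hanti.measure_iInter (fun m => (hBm m).nullMeasurableSet) ⟨0, measure_ne_top _ _⟩]
    refine le_iInf fun m => (hc m).trans (measure_mono ?_)
    exact Set.subset_iUnion_of_subset m (Set.subset_iUnion_of_subset le_rfl le_rfl)
  · have := Set.mem_iInter.1 hω m
    simp only [hB, Set.mem_iUnion] at this
    obtain ⟨k, hk, h⟩ := this
    exact ⟨k, hk, h⟩

/-! ### Convexity of the risks and extension of the margin condition. -/

section Risk

variable {Ω 𝒵 E : Type*} [MeasurableSpace Ω] {μ : Measure Ω} {n : ℕ} {Z : Fin n → Ω → 𝒵}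
  {ρ : E → 𝒵 → ℝ}

lemma excess_eq (hint : ∀ f i, Integrable (fun ω => ρ f (Z i ω)) μ) (f0 f : E) :
    excess μ Z ρ f0 f = popMean μ Z (ρ f) - popMean μ Z (ρ f0) := by
  simp only [excess, popMean, ← mul_sub, ← Finset.sum_sub_distrib]
  congr 1
  exact Finset.sum_congr rfl fun i _ => integral_sub (hint f i) (hint f0 i)

lemma convexOn_empRisk [AddCommGroup E] [Module ℝ E]
    (hconv : ∀ z, ConvexOn ℝ Set.univ fun f : E => ρ f z) (z : Fin n → 𝒵) :
    ConvexOn ℝ Set.univ fun f => empRisk z (ρ f) := by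
  refine ⟨convex_univ, fun f _ g _ s t hs ht hst => ?_⟩
  simp only [empRisk, smul_eq_mul]
  have : ∑ i, ρ (s • f + t • g) (z i) ≤ s * ∑ i, ρ f (z i) + t * ∑ i, ρ g (z i) := by
    rw [Finset.mul_sum, Finset.mul_sum, ← Finset.sum_add_distrib]
    exact Finset.sum_le_sum fun i _ => by
      simpa using (hconv (z i)).2 (Set.mem_univ f) (Set.mem_univ g) hs ht hst
  have := mul_le_mul_of_nonneg_left this (by positivity : (0 : ℝ) ≤ 1 / n)
  linarith

lemma convexOn_excess [AddCommGroup E] [Module ℝ E]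
    (hint : ∀ f i, Integrable (fun ω => ρ f (Z i ω)) μ)
    (hconv : ∀ z, ConvexOn ℝ Set.univ fun f : E => ρ f z) (f0 : E) :
    ConvexOn ℝ Set.univ (excess μ Z ρ f0) := by
  refine ⟨convex_univ, fun f _ g _ s t hs ht hst => ?_⟩
  simp only [excess_eq hint, smul_eq_mul]
  have : popMean μ Z (ρ (s • f + t • g)) ≤ s * popMean μ Z (ρ f) + t * popMean μ Z (ρ g) := by
    have : ∑ i, ∫ ω, ρ (s • f + t • g) (Z i ω) ∂μ
        ≤ s * ∑ i, ∫ ω, ρ f (Z i ω) ∂μ + t * ∑ i, ∫ ω, ρ g (Z i ω) ∂μ := by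
      rw [Finset.mul_sum, Finset.mul_sum, ← Finset.sum_add_distrib]
      refine Finset.sum_le_sum fun i _ => ?_
      rw [← integral_const_mul, ← integral_const_mul,
        ← integral_add ((hint f i).const_mul s) ((hint g i).const_mul t)]
      exact integral_mono (hint _ i) (((hint f i).const_mul s).add ((hint g i).const_mul t))
        fun ω => by simpa using (hconv (Z i ω)).2 (Set.mem_univ f) (Set.mem_univ g) hs ht hst
    have := mul_le_mul_of_nonneg_left this (by positivity : (0 : ℝ) ≤ 1 / n)
    simp only [popMean]
    linarith
  have h : popMean μ Z (ρ f0) = s * popMean μ Z (ρ f0) + t * popMean μ Z (ρ f0) := by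
    rw [← add_mul, hst, one_mul]
  linarith

lemma excess_self (f0 : E) : excess μ Z ρ f0 f0 = 0 := by simp [excess, popMean]

end Risk

/-- If the conjugate of `G` vanishes at `v`, the margin condition holds with the linear function
`u ↦ v u` on the whole of every sup-norm neighbourhood. -/
lemma linear_margin {𝒳 : Type*} {F : Submodule ℝ (𝒳 → ℝ)} {N : Seminorm ℝ F} {Xi : F → ℝ}
    (hXi : ConvexOn ℝ Set.univ Xi) {f0 : F} (h0 : Xi f0 = 0) {G : ℝ → ℝ} {η v : ℝ} (hη : 0 < η)
    (hG : ∀ f ∈ localSet F f0 η, G (N (f - f0)) ≤ Xi f) (hGv : ∀ u, 0 ≤ u → u * v ≤ G u)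
    {f : F} {C : ℝ} (hC : f ∈ localSet F f0 C) : v * N (f - f0) ≤ Xi f := by
  -- Shrinking `f` towards `f0` by this factor lands in the local set. The excess risk is convex and
  -- zero at `f0`, so it shrinks at least as fast as the linear lower bound, and `t` cancels.
  set t := η / (η + |C|) with ht
  have ht0 : 0 < t := by positivity
  have ht1 : t ≤ 1 := (div_le_one (by positivity)).2 (by linarith [abs_nonneg C])
  have htC : t * |C| ≤ η := by
    have : t * (η + |C|) = η := by rw [ht]; field_simp
    nlinarith
  set g : F := t • f + (1 - t) • f0 with hg
  have hgf : g - f0 = t • (f - f0) := by rw [hg]; module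
  have hloc : g ∈ localSet F f0 η := by
    intro x
    have e : (g : 𝒳 → ℝ) x - (f0 : 𝒳 → ℝ) x = t * ((f : 𝒳 → ℝ) x - (f0 : 𝒳 → ℝ) x) := by
      simp [hg]; ring
    rw [e, abs_mul, abs_of_pos ht0]
    exact (mul_le_mul_of_nonneg_left ((hC x).trans (le_abs_self C)) ht0.le).trans htC
  have h1 := hG g hloc
  have h2 := hGv (N (g - f0)) (apply_nonneg N _)
  have h3 : Xi g ≤ t * Xi f := by
    have := hXi.2 (Set.mem_univ f) (Set.mem_univ f0) ht0.le (sub_nonneg.2 ht1) (by ring)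
    simpa [h0] using this
  have h4 : N (g - f0) = t * N (f - f0) := by
    rw [hgf, map_smul_eq_mul, Real.norm_of_nonneg ht0.le]
  refine le_of_mul_le_mul_left ?_ ht0
  rw [h4] at h2 h1
  linarith


lemma mul_three_add_two_mul_top_div_two (x : ℝ) : (3 * (x : EReal) + 2 * ⊤) / 2 = ⊤ := by
  have h : (3 : EReal) * x = ((3 * x : ℝ) : EReal) := by norm_cast
  have h2 : (2 : EReal) ≠ ⊤ := EReal.coe_ne_top 2
  rw [h, EReal.mul_top_of_pos (by norm_num), EReal.coe_add_top,
    EReal.top_div_of_pos_ne_top (by norm_num) h2]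

lemma four_mul_top : (4 : EReal) * ⊤ = ⊤ := EReal.mul_top_of_pos (by norm_num)

lemma six_mul_coe (x : ℝ) : 6 * (x : EReal) = ((6 * x : ℝ) : EReal) := by norm_cast

/-! ### The event for the loss, and the proof of the theorem. -/

/-- With probability at least `1 - 1/p`, the empirical process indexed by the `ℓ₁`-ball of radius
`M` around `βs` is at most `λ₀ M`. -/
lemma exists_event {Ω 𝒳 : Type*} [MeasurableSpace Ω] {μ : Measure Ω} [IsProbabilityMeasure μ]
    [MeasurableSpace 𝒳] {𝒴 : Set ℝ} {n p : ℕ} (hp : 2 ≤ p) (hn : 0 < n)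
    {X : Fin n → Ω → 𝒳} {Y : Fin n → Ω → 𝒴} (hX : ∀ i, Measurable (X i))
    (hY : ∀ i, Measurable (Y i)) (hind : iIndepFun (fun i ω => (X i ω, Y i ω)) μ)
    {F : Submodule ℝ (𝒳 → ℝ)} {ρ : F → 𝒳 × 𝒴 → ℝ} (hρm : ∀ f, Measurable (ρ f))
    (hρi : ∀ f i, Integrable (fun ω => ρ f (X i ω, Y i ω)) μ) (f0 : F)
    {ψ : Fin p → F} (hψ : ∀ j, Measurable (ψ j : 𝒳 → ℝ)) {Φ : Set (Fin p → ℝ)}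
    {βs : Fin p → ℝ} (hβs : βs ∈ Φ) {γ : 𝒴 → ℝ → ℝ} {c : F → ℝ}
    (hρ : ∀ f x y, ρ f (x, y) = γ y ((f : 𝒳 → ℝ) x) + c f) {D K M : ℝ} (hD : 0 < D)
    (hLip : ∀ x y, ∀ β ∈ Φ, ∀ b ∈ Φ,
      |γ y ((lin ψ β : 𝒳 → ℝ) x) - γ y ((lin ψ b : 𝒳 → ℝ) x)|
        ≤ D * |(lin ψ β : 𝒳 → ℝ) x - (lin ψ b : 𝒳 → ℝ) x|)
    (hK : 0 < K) (hψK : ∀ j x, |(ψ j : 𝒳 → ℝ) x| ≤ K) (hM : 0 < M) :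
    ∃ E : Set Ω, MeasurableSet E ∧ ENNReal.ofReal (1 - 1 / p) ≤ μ E ∧ ∀ ω ∈ E,
      ∀ β ∈ Φ, l1norm (β - βs) ≤ M →
        (excess μ (fun i ω => (X i ω, Y i ω)) ρ f0 (lin ψ β)
            - excess μ (fun i ω => (X i ω, Y i ω)) ρ f0 (lin ψ βs))
          - (empRisk (fun i => (X i ω, Y i ω)) (ρ (lin ψ β))
            - empRisk (fun i => (X i ω, Y i ω)) (ρ (lin ψ βs)))
        ≤ 5 * K * D * Real.sqrt (Real.log p / n) * M := by
  -- Subtracting the difference of the constants `c` leaves increments of `γ` alone, to which the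
  -- Lipschitz bound applies; centring cancels the constants anyway.
  set g : (Fin p → ℝ) → 𝒳 × 𝒴 → ℝ := fun a z =>
    ρ (lin ψ (βs + a)) z - ρ (lin ψ βs) z - (c (lin ψ (βs + a)) - c (lin ψ βs)) with hg
  have hgγ : ∀ a z, g a z = γ z.2 ((lin ψ (βs + a) : 𝒳 → ℝ) z.1)
      - γ z.2 ((lin ψ βs : 𝒳 → ℝ) z.1) := by
    rintro a ⟨x, y⟩
    simp only [hg, hρ]; ring
  obtain ⟨E, hEm, hEp, hE⟩ := exists_measurableSet_forall_le (μ := μ) hn hp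
    (fun i => (hX i).prodMk (hY i)) hind (A := {a | βs + a ∈ Φ ∧ l1norm a ≤ M})
    ⟨by simpa using hβs, by simpa [l1norm] using hM.le⟩
    (ψ := fun j z => (ψ j : 𝒳 → ℝ) z.1) (g := g) (M := M) (K := K) (D := D)
    (fun a _ => ((hρm _).sub (hρm _)).sub_const _) (fun j => (hψ j).comp measurable_fst) hK hD hM
    (fun a ha => ha.2) (fun j z => hψK j z.1)
    (fun a ha b hb z => by
      rw [hgγ, hgγ, sub_sub_sub_cancel_right]
      refine (hLip z.1 z.2 _ ha.1 _ hb.1).trans (le_of_eq ?_)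
      simp only [lin_add, Submodule.coe_add, Pi.add_apply, add_sub_add_left_eq_sub, lin_apply])
    (fun z => by simp [hg])
  refine ⟨E, hEm, hEp, fun ω hω β hβ hβM => ?_⟩
  have h := hE ω hω (β - βs) ⟨by simpa using hβ, hβM⟩
  refine le_trans (le_of_eq ?_) h
  rw [excess_eq hρi, excess_eq hρi]
  have hI : ∀ l, ∫ ω', g (β - βs) (X l ω', Y l ω') ∂μ
      = ∫ ω', ρ (lin ψ β) (X l ω', Y l ω') ∂μ - ∫ ω', ρ (lin ψ βs) (X l ω', Y l ω') ∂μ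
        - (c (lin ψ β) - c (lin ψ βs)) := by
    intro l
    simp only [hg, add_sub_cancel]
    have h1 : Integrable (fun ω' => ρ (lin ψ β) (X l ω', Y l ω')
        - ρ (lin ψ βs) (X l ω', Y l ω')) μ := (hρi _ l).sub (hρi _ l)
    rw [integral_sub h1 (integrable_const _), integral_sub (hρi _ l) (hρi _ l)]
    simp
  simp only [hI]
  simp only [hg, add_sub_cancel, popMean, empRisk, Finset.sum_sub_distrib]
  ring

end ElasticNet

open ElasticNet
theorem theorem3 (K : ℝ) (hK : 0 < K) :
    ∃ d : ℝ, 0 < d ∧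
    ∀ (n p : ℕ) (_ : 2 ≤ p) (_ : Real.log p ≤ n)
      -- the sample: independent, not necessarily identically distributed
      (Ω : Type*) (_ : MeasurableSpace Ω) (μ : Measure Ω) (_ : IsProbabilityMeasure μ)
      (𝒳 : Type*) (_ : MeasurableSpace 𝒳) (𝒴 : Set ℝ)
      (X : Fin n → Ω → 𝒳) (Y : Fin n → Ω → 𝒴)
      (_ : ∀ i, Measurable (X i)) (_ : ∀ i, Measurable (Y i))
      (_ : iIndepFun (fun i ω => (X i ω, Y i ω)) μ)
      -- the function space with its (semi)norm, and the convex loss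
      (F : Submodule ℝ (𝒳 → ℝ)) (N : Seminorm ℝ F)
      (ρ : F → 𝒳 × 𝒴 → ℝ)
      (_ : ∀ f, Measurable (ρ f))
      (_ : ∀ f i, Integrable (fun ω => ρ f (X i ω, Y i ω)) μ)
      (_ : ∀ z, ConvexOn ℝ Set.univ (fun f : F => ρ f z))
      -- the target
      (f0 : F)
      (_ : ∀ f : F, popMean μ (fun i ω => (X i ω, Y i ω)) (ρ f0)
        ≤ popMean μ (fun i ω => (X i ω, Y i ω)) (ρ f))
      -- the excess risk
      (Xi : F → ℝ)
      (_ : Xi = excess μ (fun i ω => (X i ω, Y i ω)) ρ f0)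
      -- the basis functions and the parameter set
      (ψ : Fin p → F) (_ : ∀ j, Measurable (ψ j : 𝒳 → ℝ))
      (Φ : Set (Fin p → ℝ)) (_ : Convex ℝ Φ)
      -- structure of the loss, Lipschitz condition, bounds on the basis functions
      (γ : 𝒴 → ℝ → ℝ) (c : F → ℝ)
      (_ : ∀ f x y, ρ f (x, y) = γ y ((f : 𝒳 → ℝ) x) + c f)
      (D : ℝ) (_ : 0 < D)
      (_ : ∀ x y, ∀ β ∈ Φ, ∀ b ∈ Φ,
        |γ y ((lin ψ β : 𝒳 → ℝ) x) - γ y ((lin ψ b : 𝒳 → ℝ) x)|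
          ≤ D * |(lin ψ β : 𝒳 → ℝ) x - (lin ψ b : 𝒳 → ℝ) x|)
      (_ : (1 / (n : ℝ)) * ∑ i, (⨆ j, ∫ ω, ((ψ j : 𝒳 → ℝ) (X i ω)) ^ 2 ∂μ) ≤ 1)
      (_ : ∀ j x, |(ψ j : 𝒳 → ℝ) x| ≤ K)
      -- the margin condition
      (η : ℝ) (_ : 0 < η)
      (G : ℝ → ℝ) (_ : StrictConvexOn ℝ (Set.Ici 0) G) (_ : G 0 = 0)
      (_ : ∀ f ∈ localSet F f0 η, G (N (f - f0)) ≤ Xi f)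
      -- the tuning parameters
      (l0 l1 l2 : ℝ) (_ : l0 = d * D * Real.sqrt (Real.log p / n))
      (_ : 8 * l0 ≤ l1) (_ : 0 ≤ l2)
      -- the oracle, the local approximation and the restricted eigenvalue conditions
      (Γ : Set (Finset (Fin p))) (βs : Fin p → ℝ)
      (_ : IsOracle Xi N ψ G l1 l2 Φ Γ βs)
      (_ : lin ψ βs ∈ localSet F f0 η)
      (_ : ∀ β ∈ Φ, ((l1norm (β - βs) : ℝ) : EReal)
          ≤ oracleBound Xi N ψ G l1 l2 βs / (l0 : EReal) →
        lin ψ β ∈ localSet F f0 η)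
      (_ : 0 < phi N ψ l1 l2 βs)
      -- the elastic net estimator
      (βh : Ω → Fin p → ℝ)
      (_ : ∀ ω, IsElasticNet ρ ψ l1 l2 Φ (fun i => (X i ω, Y i ω)) (βh ω)),
      (∃ A : Set Ω, MeasurableSet A ∧ 1 - 1 / (p : ℝ) ≤ μ.real A ∧ ∀ ω ∈ A,
        ((Xi (lin ψ (βh ω)) + l1 * l1norm (βh ω - βs)
          + l2 * l2norm (restr (supp βs) (βh ω) - restr (supp βs) βs) ^ 2 : ℝ) : EReal)
            ≤ 4 * oracleBound Xi N ψ G l1 l2 βs) ∧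
      4 * oracleBound Xi N ψ G l1 l2 βs
        = 6 * ((Xi (lin ψ βs) : ℝ) : EReal) + 4 * estError N ψ G l1 l2 βs := by
  -- With `d = 5 * K`, `l0` is exactly the rate in `exists_event`.
  refine ⟨5 * K, by positivity, ?_⟩
  intro n p hp hlogn Ω _ μ _ 𝒳 _ 𝒴 X Y hX hY hind F N ρ hρm hρi hρc f0 hf0 Xi hXi ψ hψ Φ hΦ γ c
    hρ D hD hLip _ hψK η hη G hGc hG0 hmargin l0 l1 l2 hl0 hl1 hl2 Γ βs horacle hloc hlocM hφ βh hβh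
  have hlog : 0 < Real.log p := Real.log_pos (by exact_mod_cast hp)
  have hn : 0 < n := by
    have : (0 : ℝ) < n := hlog.trans_le hlogn
    exact_mod_cast this
  have hl0pos : 0 < l0 := by
    rw [hl0]
    have : 0 < Real.sqrt (Real.log p / n) := Real.sqrt_pos.2 (by positivity)
    positivity
  have hl1pos : 0 < l1 := by linarith
  have hβs : βs ∈ Φ := horacle.1
  have hXi0 : ∀ f, 0 ≤ Xi f := fun f => by
    rw [hXi, excess_eq hρi]; exact sub_nonneg.2 (hf0 f)
  set a : ℝ := 4 * l1 * Real.sqrt ((supp βs).card : ℝ) + 4 * l2 * l2norm βs with ha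
  have ha0 : 0 ≤ a := add_nonneg (by positivity) (mul_nonneg (by positivity) (l2norm_nonneg _))
  have hest : estError N ψ G l1 l2 βs = conj G (ENNReal.ofReal a / phi N ψ l1 l2 βs) := rfl
  set w : ℝ≥0∞ := ENNReal.ofReal a / phi N ψ l1 l2 βs with hw
  have hwtop : w ≠ ⊤ := ENNReal.div_ne_top ENNReal.ofReal_ne_top hφ.ne'
  have hHnn : 0 ≤ estError N ψ G l1 l2 βs := conj_nonneg hG0
  by_cases htop : estError N ψ G l1 l2 βs = ⊤
  · have hbound : oracleBound Xi N ψ G l1 l2 βs = ⊤ := by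
      rw [oracleBound, oracleObj, htop]
      exact mul_three_add_two_mul_top_div_two _
    refine ⟨⟨Set.univ, MeasurableSet.univ, by simp, fun ω _ => ?_⟩, ?_⟩
    · rw [hbound, four_mul_top]; exact le_top
    · rw [hbound, htop, four_mul_top, EReal.add_top_of_ne_bot]
      rw [six_mul_coe]; exact EReal.coe_ne_bot _
  obtain ⟨H, hH⟩ : ∃ H : ℝ, estError N ψ G l1 l2 βs = (H : EReal) :=
    ⟨_, (EReal.coe_toReal htop (ne_bot_of_le_ne_bot EReal.zero_ne_bot hHnn)).symm⟩
  rw [hH] at hHnn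
  have hH0 : 0 ≤ H := by exact_mod_cast hHnn
  set Δ : ℝ := (3 * Xi (lin ψ βs) + 2 * H) / 2 with hΔ
  have hbound : oracleBound Xi N ψ G l1 l2 βs = (Δ : EReal) := by
    rw [oracleBound, oracleObj, hH, hΔ]
    norm_cast
  have hΔ0 : 0 ≤ Δ := by have := hXi0 (lin ψ βs); rw [hΔ]; positivity
  rw [hbound] at hlocM ⊢
  have hfour : 4 * (Δ : EReal) = ((4 * Δ : ℝ) : EReal) := by norm_cast
  rw [hfour]
  refine ⟨?_, by
    have h : 4 * Δ = 6 * Xi (lin ψ βs) + 4 * H := by rw [hΔ]; ring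
    rw [hH, h, EReal.coe_add, EReal.coe_mul, EReal.coe_mul]; rfl⟩
  have hGH : ∀ u, 0 ≤ u → u * w.toReal - G u ≤ H := fun u hu => by
    have := le_conj G hwtop hu
    rw [← hest, hH] at this
    exact_mod_cast this
  have hXiconv : ConvexOn ℝ Set.univ Xi := by rw [hXi]; exact convexOn_excess hρi hρc f0
  have hXif0 : Xi f0 = 0 := by rw [hXi]; exact excess_self f0
  have event := fun (M : ℝ) (hM : 0 < M) => exists_event hp hn hX hY hind hρm hρi f0 hψ hβs hρ hD
    hLip hK hψK hM
  rw [← hXi, ← hl0] at event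
  -- The radius stays free: it is `Δ / l0` when `Δ > 0`, and a sequence tending to `0` when `Δ = 0`.
  have conclude : ∀ M, 0 < M → Δ ≤ l0 * M →
      (∀ β ∈ Φ, l1norm (β - βs) ≤ M →
        w.toReal * N (lin ψ β - f0) ≤ Xi (lin ψ β) + H) →
      ∀ ω, (∀ β ∈ Φ, l1norm (β - βs) ≤ M → (Xi (lin ψ β) - Xi (lin ψ βs))
        - (empRisk (fun i => (X i ω, Y i ω)) (ρ (lin ψ β))
          - empRisk (fun i => (X i ω, Y i ω)) (ρ (lin ψ βs))) ≤ l0 * M) →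
      Xi (lin ψ (βh ω)) + l1 * l1norm (βh ω - βs)
          + l2 * l2norm (restr (supp βs) (βh ω) - restr (supp βs) βs) ^ 2 ≤ 4 * (l0 * M) := by
    intro M hM hΔM hNM ω hω
    rw [restr_sub]
    exact oracle_inequality_of_isMin (R := fun f => empRisk (fun i => (X i ω, Y i ω)) (ρ f))
      hl0pos hl1 hl2 ENNReal.toReal_nonneg hΦ hβs hM (convexOn_empRisk hρc _) hω hNM
      (fun δ hδ => mul_l2norm_le_of_cone hφ ha0 hδ) hH0 hXi0 (by linarith) (hβh ω).1
      ((hβh ω).2 βs hβs)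
  have hp1 : ∀ {E : Set Ω}, ENNReal.ofReal (1 - 1 / p) ≤ μ E → 1 - 1 / (p : ℝ) ≤ μ.real E :=
    fun h => (ENNReal.ofReal_le_iff_le_toReal (measure_ne_top _ _)).1 h
  rcases hΔ0.eq_or_lt with hΔz | hΔpos
  -- Degenerate case `Δ = 0`: the locality hypothesis now covers only `βs`. Since `H = 0`, `G`
  -- dominates a linear function, and the margin bound extends to every `β`.
  · have hXs : Xi (lin ψ βs) = 0 := by have := hXi0 (lin ψ βs); linarith
    have hHz : H = 0 := by have := hXi0 (lin ψ βs); linarith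
    have hGv : ∀ u, 0 ≤ u → u * w.toReal ≤ G u := fun u hu => by
      have := hGH u hu; linarith
    have hN : ∀ β, w.toReal * N (lin ψ β - f0) ≤ Xi (lin ψ β) + H := fun β => by
      rw [hHz, add_zero]
      refine linear_margin hXiconv hXif0 hη hmargin hGv (C := l1norm (β - βs) * K + η) fun x => ?_
      have e : (lin ψ β : 𝒳 → ℝ) x - (f0 : 𝒳 → ℝ) x = ∑ j, (β - βs) j * (ψ j : 𝒳 → ℝ) x
          + ((lin ψ βs : 𝒳 → ℝ) x - (f0 : 𝒳 → ℝ) x) := by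
        rw [← lin_apply, lin_sub]; simp
      rw [e]
      exact (abs_add_le _ _).trans
        (add_le_add (abs_sum_mul_le hK.le le_rfl fun j => hψK j x) (hloc x))
    choose E hEm hEp hE using fun k : ℕ => event (1 / ((k : ℝ) + 1)) (by positivity)
    -- The events for the radii `1 / (k + 1)` need not be nested. Their limit superior still has
    -- probability at least `1 - 1/p`, and on it the bound `4 * l0 / (k + 1)` holds for arbitrarily
    -- large `k`.
    obtain ⟨A, hAm, hAp, hA⟩ := exists_measurableSet_frequently hEm hEp
    refine ⟨A, hAm, hp1 hAp, fun ω hω => ?_⟩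
    rw [EReal.coe_le_coe_iff, ← hΔz, mul_zero]
    refine le_of_forall_pos_le_add fun ε hε => ?_
    obtain ⟨m, hm⟩ := exists_nat_one_div_lt (show 0 < ε / (4 * l0) by positivity)
    obtain ⟨k, hk, hωk⟩ := hA ω hω m
    have hkm : 1 / ((k : ℝ) + 1) ≤ 1 / ((m : ℝ) + 1) :=
      one_div_le_one_div_of_le (by positivity) (by exact_mod_cast Nat.succ_le_succ hk)
    refine (conclude _ (by positivity) (by rw [← hΔz]; positivity) (fun β _ _ => hN β) ω
      (hE k ω hωk)).trans ?_
    have := (lt_div_iff₀ (by positivity)).1 (hkm.trans_lt hm)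
    linarith
  -- For `Δ > 0` the radius is `M*`, so the locality hypothesis supplies the margin condition
  -- throughout the ball.
  · have hM : l0 * (Δ / l0) = Δ := by field_simp
    obtain ⟨E, hEm, hEp, hE⟩ := event (Δ / l0) (by positivity)
    refine ⟨E, hEm, hp1 hEp, fun ω hω => ?_⟩
    have := conclude (Δ / l0) (by positivity) hM.ge (fun β hβ hβM => ?_) ω (hE ω hω)
    · rw [hM] at this
      exact_mod_cast this
    · have h1 := hmargin _ (hlocM β hβ (by rw [← EReal.coe_div]; exact_mod_cast hβM))
      have h2 := hGH (N (lin ψ β - f0)) (apply_nonneg N _)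
      linarith
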